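/- **Proposition 4.4.** Let $p$ be a prime and $n\ge 1$. Spaces are compactly generated, and maps and homotopies are pointed. Let $X=\Sigma X'$ be a $p$-local suspension, where $X'$ has the pointed homotopy type of a pointed CW complex; here $p$-local means that $X$ is simply connected and all its homotopy groups are $\mathbb Z_{(p)}$-modules. Let $X^{(n)}$ be the $n$-fold self smash product of $X$, on which $\Sigma_n$ acts by permuting positions, and use the suspension coordinate to add maps $X^{(n)}\to X^{(n)}$, so that every $\alpha=\sum_{\sigma}k_\sigma\sigma$ in the group ring $\mathbb Z_{(p)}(\Sigma_n)$ has a homotopy class $[\alpha]\in[X^{(n)},X^{(n)}]$, the unique class $c$ such that $Nc=\sum_\sigma (Nk_\sigma)[\sigma]$ for an integer $N$ prime to $p$ with all $Nk_\sigma\in\mathbb Z$. The smallest functorial retract $M_n(X)$ of $X^{(n)}$ is defined as follows. A functorial retract of the functor $V\mapsto V^{\otimes n}$ on $\mathbb Z_{(p)}$-modules is the image of a natural idempotent $\varepsilon_V\colon V^{\otimes n}\to V^{\otimes n}$; it contains the bottom cell if $\varepsilon_V(v\otimes\cdots\otimes v)=v\otimes\cdots\otimes v$ for all $V$ and all $v\in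 V$. Let $\varepsilon$ give a smallest functorial retract that contains the bottom cell, that is, one that contains the bottom cell while none of its proper functorial retracts does. Then $\varepsilon$ is given by the action, by permuting positions, of an element $e\in\mathbb Z_{(p)}(\Sigma_n)$, and $$M_n(X)=\operatorname{hocolim}_{e}X^{(n)}=\operatorname{hocolim}\bigl(X^{(n)}\xrightarrow{\,e\,}X^{(n)}\xrightarrow{\,e\,}X^{(n)}\to\cdots\bigr),$$ the reduced mapping telescope of a map $X^{(n)}\to X^{(n)}$ in the class $[e]$. Then the trace map $\phi_n=\sum_{\sigma\in\Sigma_n}\sigma\colon X^{(n)}\to X^{(n)}$ factors up to homotopy through $M_n(X)$: there is a map $b\colon M_n(X)\to X^{(n)}$ such that $\phi_n\simeq b\circ i$, where $i\colon X^{(n)}\to M_n(X)$ is the inclusion of the first term of the telescope. -/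

import Mathlib

noncomputable section

open scoped unitInterval TensorProduct

namespace LabelTrace

universe u v w

/-! ### Pointed spaces and pointed homotopy classes -/

/-- A chosen base point of a space. -/
class Based (X : Type u) where
  pt : X

/-- Base-point preserving continuous maps. -/
structure PMap (X : Type u) (Y : Type v) [TopologicalSpace X] [Based X]
    [TopologicalSpace Y] [Based Y] where
  toMap : C(X, Y)
  map_pt : toMap Based.pt = Based.pt

namespace PMap

variable {X : Type u} {Y : Type v} {Z : Type w} [TopologicalSpace X] [Based X]
  [TopologicalSpace Y] [Based Y] [TopologicalSpace Z] [Based Z]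

/-- The identity map. -/
def id (X : Type u) [TopologicalSpace X] [Based X] : PMap X X := ⟨ContinuousMap.id X, rfl⟩

/-- Composition `g ∘ f`. -/
def comp (g : PMap Y Z) (f : PMap X Y) : PMap X Z :=
  ⟨g.toMap.comp f.toMap, by simp [f.map_pt, g.map_pt]⟩

/-- The constant map to the base point. -/
def const (X : Type u) (Y : Type v) [TopologicalSpace X] [Based X]
    [TopologicalSpace Y] [Based Y] : PMap X Y := ⟨ContinuousMap.const X Based.pt, rfl⟩

/-- Pointed homotopy: a homotopy through base-point preserving maps. -/
def Homotopic (f g : PMap X Y) : Prop := f.toMap.HomotopicRel g.toMap {Based.pt}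

/-- Pointed homotopy is an equivalence relation. -/
instance homotopySetoid (X : Type u) (Y : Type v) [TopologicalSpace X] [Based X]
    [TopologicalSpace Y] [Based Y] : Setoid (PMap X Y) where
  r := Homotopic
  iseqv := ⟨fun f => .refl f.toMap, fun h => h.symm, fun h k => h.trans k⟩

theorem ext_apply {f g : PMap X Y} (h : ∀ x, f.toMap x = g.toMap x) : f = g := by
  cases f; cases g; congr; exact ContinuousMap.ext h

/-- A pointed homotopy, from a jointly continuous family of functions. -/
theorem homotopic_of_family (f g : PMap X Y) (H : I → X → Y)
    (hc : Continuous fun q : I × X => H q.1 q.2) (h0 : ∀ x, H 0 x = f.toMap x)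
    (h1 : ∀ x, H 1 x = g.toMap x) (hp : ∀ s, H s Based.pt = Based.pt) : f.Homotopic g :=
  ⟨{ toFun := fun q => H q.1 q.2
     continuous_toFun := hc
     map_zero_left := h0
     map_one_left := h1
     prop' := by
      rintro s x rfl
      exact (hp s).trans f.map_pt.symm }⟩

/-- A family of functions out of a pointed homotopy. -/
theorem Homotopic.family {f g : PMap X Y} (h : f.Homotopic g) : ∃ H : I → X → Y,
    (Continuous fun q : I × X => H q.1 q.2) ∧ (∀ x, H 0 x = f.toMap x) ∧
    (∀ x, H 1 x = g.toMap x) ∧ ∀ s, H s Based.pt = Based.pt := by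
  obtain ⟨F⟩ := h
  refine ⟨fun s x => F (s, x), F.continuous_toFun, fun x => F.apply_zero x, fun x => F.apply_one x,
    fun s => ?_⟩
  exact (F.eq_fst s (Set.mem_singleton _)).trans f.map_pt

end PMap

/-- The set `[X, Y]` of pointed homotopy classes of pointed maps. -/
def HClass (X : Type u) (Y : Type v) [TopologicalSpace X] [Based X]
    [TopologicalSpace Y] [Based Y] := Quotient (PMap.homotopySetoid X Y)

/-- The pointed homotopy class of a map. -/
def PMap.cls {X : Type u} {Y : Type v} [TopologicalSpace X] [Based X]
    [TopologicalSpace Y] [Based Y] (f : PMap X Y) : HClass X Y := Quotient.mk _ f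

/-- `X` has the pointed homotopy type of a CW complex having its base point as a vertex
(that is, of a CW complex relative to its base point). -/
def HasPointedCWType (X : Type u) [TopologicalSpace X] [Based X] : Prop :=
  ∃ (K : Type u) (_ : TopologicalSpace K) (_ : Based K) (_ : T2Space K)
    (_ : Topology.RelCWComplex (Set.univ : Set K) {(Based.pt : K)})
    (f : PMap X K) (g : PMap K X),
    (g.comp f).Homotopic (PMap.id X) ∧ (f.comp g).Homotopic (PMap.id K)

/-! ### Suspensions and smash powers -/

/-- The equivalence relation that collapses the set `S` to a point. -/
def collapse {Y : Type u} (S : Set Y) : Setoid Y where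
  r x y := x = y ∨ (x ∈ S ∧ y ∈ S)
  iseqv := by
    refine ⟨fun _ => .inl rfl, ?_, ?_⟩
    · rintro x y (rfl | ⟨h, k⟩)
      exacts [.inl rfl, .inr ⟨k, h⟩]
    · rintro x y z (rfl | ⟨h, k⟩) (rfl | ⟨h', k'⟩)
      exacts [.inl rfl, .inr ⟨h', k'⟩, .inr ⟨h, k⟩, .inr ⟨h, k'⟩]

/-- The part of `A × [0,1]` that is collapsed in the reduced suspension. -/
def suspBase (A : Type u) [Based A] : Set (A × I) :=
  {z | z.1 = Based.pt ∨ z.2 = 0 ∨ z.2 = 1}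

/-- The reduced suspension `ΣA`, with the quotient topology. -/
def Susp (A : Type u) [TopologicalSpace A] [Based A] : Type u :=
  Quotient (collapse (suspBase A))

section Susp

variable {A : Type u} [TopologicalSpace A] [Based A]

instance : TopologicalSpace (Susp A) :=
  inferInstanceAs (TopologicalSpace (Quotient (collapse (suspBase A))))

/-- The point `[a, t]` of the suspension. -/
def Susp.mk (a : A) (t : I) : Susp A := Quotient.mk (collapse (suspBase A)) (a, t)

instance : Based (Susp A) := ⟨Susp.mk Based.pt 0⟩

end Susp

/-- The `n`-fold product in the category of compactly generated spaces: the product topology is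
replaced by the final topology for all maps from compact Hausdorff spaces. -/
abbrev KProd (n : ℕ) (X : Type u) [TopologicalSpace X] : Type u :=
  Topology.WithGeneratedByTopology (fun K : CompHaus.{u} => (K : Type u)) (Fin n → X)

/-- The fat wedge. -/
def fatWedge (n : ℕ) (X : Type u) [TopologicalSpace X] [Based X] : Set (KProd n X) :=
  {x | ∃ i, Topology.WithGeneratedByTopology.equiv x i = Based.pt}

/-- The `n`-fold self smash product `X^{(n)}` (for `n ≥ 1`): the compactly generated `n`-fold
product with the fat wedge collapsed to the base point. -/
def Smash (n : ℕ) (X : Type u) [TopologicalSpace X] [Based X] : Type u :=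
  Quotient (collapse (fatWedge n X))

section Smash

variable {n : ℕ} {X : Type u} [TopologicalSpace X] [Based X]

instance : TopologicalSpace (Smash n X) :=
  inferInstanceAs (TopologicalSpace (Quotient (collapse (fatWedge n X))))

/-- The point `x₁ ∧ ⋯ ∧ xₙ`. -/
def Smash.mk (x : Fin n → X) : Smash n X :=
  Quotient.mk (collapse (fatWedge n X)) (Topology.WithGeneratedByTopology.equiv.symm x)

instance : Based (Smash n X) := ⟨Smash.mk fun _ => Based.pt⟩

end Smash

/-! ### Continuity criteria -/

section Continuity

theorem Susp.ind {A : Type u} [TopologicalSpace A] [Based A] {p : Susp A → Prop}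
    (h : ∀ a t, p (Susp.mk a t)) (z : Susp A) : p z :=
  Quotient.ind (fun q => h q.1 q.2) z

theorem Susp.mk_eq_iff {A : Type u} [TopologicalSpace A] [Based A] {a b : A} {s t : I} :
    Susp.mk a s = Susp.mk b t ↔ (a = b ∧ s = t) ∨ ((a = Based.pt ∨ s = 0 ∨ s = 1) ∧
      (b = Based.pt ∨ t = 0 ∨ t = 1)) := by
  refine (Quotient.eq (r := collapse (suspBase A))).trans ?_
  change ((a, s) = (b, t) ∨ _) ↔ _
  rw [Prod.mk.injEq]
  exact Iff.rfl

theorem Susp.mk_eq_pt {A : Type u} [TopologicalSpace A] [Based A] {a : A} {s : I} :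
    Susp.mk a s = Based.pt ↔ (a = Based.pt ∨ s = 0 ∨ s = 1) := by
  change Susp.mk a s = Susp.mk _ _ ↔ _
  rw [Susp.mk_eq_iff]
  simp only [true_or, or_true, and_true]
  constructor
  · rintro (⟨h, -⟩ | h)
    exacts [.inl h, h]
  · exact .inr

theorem Susp.continuous_mk {A : Type u} [TopologicalSpace A] [Based A] :
    Continuous fun q : A × I => Susp.mk q.1 q.2 :=
  continuous_quotient_mk'

theorem Smash.ind {n : ℕ} {X : Type u} [TopologicalSpace X] [Based X] {p : Smash n X → Prop}
    (h : ∀ x, p (Smash.mk x)) (z : Smash n X) : p z :=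
  Quotient.ind (fun q => h q) z

theorem Smash.mk_eq_pt {n : ℕ} {X : Type u} [TopologicalSpace X] [Based X] {x : Fin n → X}
    {i : Fin n} (h : x i = Based.pt) : Smash.mk x = Based.pt :=
  Quotient.sound (.inr ⟨⟨i, h⟩, ⟨i, rfl⟩⟩)

/-- A function out of `X^{(n)}` from a function on the product. -/
def Smash.lift {n : ℕ} {X : Type u} [TopologicalSpace X] [Based X] {Z : Type v}
    (F : (Fin n → X) → Z) (z₀ : Z) (h : ∀ x, (∃ i, x i = Based.pt) → F x = z₀) :
    Smash n X → Z :=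
  Quotient.lift (fun x => F (Topology.WithGeneratedByTopology.equiv x)) (by
    rintro x y (rfl | ⟨hx, hy⟩)
    · rfl
    · rw [h _ hx, h _ hy])

@[simp] theorem Smash.lift_mk {n : ℕ} {X : Type u} [TopologicalSpace X] [Based X] {Z : Type v}
    (F : (Fin n → X) → Z) (z₀ : Z) (h) (x : Fin n → X) :
    Smash.lift F z₀ h (Smash.mk x) = F x := rfl

theorem Smash.continuous_iff {n : ℕ} {X : Type u} [TopologicalSpace X] [Based X] {Z : Type v}
    [TopologicalSpace Z] (F : Smash n X → Z) : Continuous F ↔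
      ∀ (K : CompHaus.{u}) (f : C(K, Fin n → X)), Continuous fun k => F (Smash.mk (f k)) := by
  have hq : Topology.IsQuotientMap (Quotient.mk (collapse (fatWedge n X))) := isQuotientMap_quotient_mk'
  refine hq.continuous_iff.trans ?_
  exact Topology.WithGeneratedByTopology.continuous_from_iff _

theorem Smash.continuous_mk_comp {n : ℕ} {X : Type u} [TopologicalSpace X] [Based X]
    {K : Type u} [TopologicalSpace K] [CompactSpace K] [T2Space K] (f : C(K, Fin n → X)) :
    Continuous fun k => (Smash.mk (f k) : Smash n X) :=
  (Smash.continuous_iff id).1 continuous_id (CompHaus.of K) f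

/-- Joint continuity with a locally compact parameter space. -/
theorem Smash.continuous_param {n : ℕ} {X : Type u} [TopologicalSpace X] [Based X] {Z : Type v}
    [TopologicalSpace Z] {P : Type w} [TopologicalSpace P] [LocallyCompactSpace P]
    (F : P → Smash n X → Z)
    (h : ∀ (K : CompHaus.{u}) (f : C(K, Fin n → X)),
      Continuous fun q : P × K => F q.1 (Smash.mk (f q.2))) :
    Continuous fun q : P × Smash n X => F q.1 q.2 := by
  have h1 : ∀ z, Continuous fun p => F p z := Smash.ind fun x => by
    have := h (CompHaus.of PUnit) (ContinuousMap.const _ x)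
    exact this.comp (by fun_prop : Continuous fun p : P => (p, PUnit.unit))
  let G : Smash n X → C(P, Z) := fun z => ⟨fun p => F p z, h1 z⟩
  have hG : Continuous G := by
    rw [Smash.continuous_iff]
    intro K f
    refine ContinuousMap.continuous_of_continuous_uncurry _ ?_
    exact (h K f).comp continuous_swap
  have := ContinuousMap.continuous_uncurry_of_continuous ⟨G, hG⟩
  exact this.comp continuous_swap

theorem Susp.continuous_param {A : Type u} [TopologicalSpace A] [Based A] {Z : Type v}
    [TopologicalSpace Z] {P : Type w} [TopologicalSpace P] [LocallyCompactSpace P]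
    (F : P → Susp A → Z)
    (h : Continuous fun q : P × (A × I) => F q.1 (Susp.mk q.2.1 q.2.2)) :
    Continuous fun q : P × Susp A => F q.1 q.2 := by
  have h1 : ∀ z, Continuous fun p => F p z := Susp.ind fun a t =>
    h.comp (by fun_prop : Continuous fun p : P => (p, (a, t)))
  let G : Susp A → C(P, Z) := fun z => ⟨fun p => F p z, h1 z⟩
  have hG : Continuous G := by
    have hq : Topology.IsQuotientMap (Quotient.mk (collapse (suspBase A))) := isQuotientMap_quotient_mk'
    refine hq.continuous_iff.2 (ContinuousMap.continuous_of_continuous_uncurry _ ?_)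
    exact h.comp continuous_swap
  have := ContinuousMap.continuous_uncurry_of_continuous ⟨G, hG⟩
  exact this.comp continuous_swap

end Continuity

/-! ### The group structure on `[(ΣA)^{(n)}, W]` -/

section Reparam

/-- `θ` maps the end points of the unit interval to end points. -/
def EndPres (θ : I → I) : Prop := (θ 0 = 0 ∨ θ 0 = 1) ∧ (θ 1 = 0 ∨ θ 1 = 1)

variable {A : Type u} [TopologicalSpace A] [Based A]

/-- The map `[a, t] ↦ [a, θ t]` of the suspension. -/
def Susp.reparam (θ : I → I) (h : EndPres θ) : Susp A → Susp A :=
  Quotient.lift (fun q : A × I => Susp.mk q.1 (θ q.2)) (by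
    have key : ∀ q : A × I, q ∈ suspBase A → Susp.mk q.1 (θ q.2) = Based.pt := by
      rintro ⟨a, t⟩ (h' | h' | h')
      · exact Susp.mk_eq_pt.2 (.inl h')
      · dsimp only at h'
        subst h'
        exact Susp.mk_eq_pt.2 (.inr h.1)
      · dsimp only at h'
        subst h'
        exact Susp.mk_eq_pt.2 (.inr h.2)
    rintro x y (rfl | ⟨hx, hy⟩)
    · rfl
    · rw [key x hx, key y hy])

@[simp] theorem Susp.reparam_mk (θ : I → I) (h : EndPres θ) (a : A) (t : I) :
    Susp.reparam θ h (Susp.mk a t) = Susp.mk a (θ t) := rfl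

theorem Susp.reparam_pt (θ : I → I) (h : EndPres θ) :
    Susp.reparam θ h (Based.pt : Susp A) = Based.pt :=
  Susp.mk_eq_pt.2 (.inl rfl)

theorem Susp.continuous_reparam {P : Type w} [TopologicalSpace P] [LocallyCompactSpace P]
    (θ : P → I → I) (h : ∀ p, EndPres (θ p)) (hc : Continuous fun q : P × I => θ q.1 q.2) :
    Continuous fun q : P × Susp A => Susp.reparam (θ q.1) (h q.1) q.2 := by
  refine Susp.continuous_param (fun p z => Susp.reparam (θ p) (h p) z) ?_
  have : Continuous fun q : P × (A × I) => (q.2.1, θ q.1 q.2.2) :=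
    (by fun_prop : Continuous fun q : P × (A × I) => q.2.1).prodMk
      (hc.comp (by fun_prop : Continuous fun q : P × (A × I) => (q.1, q.2.2)))
  exact Susp.continuous_mk.comp this

/-- `t ↦ 2t`, cut off at `1`. -/
def low (t : I) : I := Set.projIcc 0 1 zero_le_one (2 * (t : ℝ))

/-- `t ↦ 2t - 1`, cut off at `0`. -/
def high (t : I) : I := Set.projIcc 0 1 zero_le_one (2 * (t : ℝ) - 1)

theorem continuous_low : Continuous low := by unfold low; fun_prop

theorem continuous_high : Continuous high := by unfold high; fun_prop

theorem coe_low (t : I) : (low t : ℝ) = min 1 (2 * (t : ℝ)) := by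
  have := t.2.1
  simp [low, Set.coe_projIcc, this]

theorem coe_high (t : I) : (high t : ℝ) = max 0 (2 * (t : ℝ) - 1) := by
  have := t.2.2
  rw [high, Set.coe_projIcc, min_eq_right (by linarith)]

theorem low_eq_one {t : I} (h : 1 / 2 ≤ (t : ℝ)) : low t = 1 :=
  Subtype.ext (by rw [coe_low, min_eq_left (by linarith)]; rfl)

theorem high_eq_zero {t : I} (h : (t : ℝ) ≤ 1 / 2) : high t = 0 :=
  Subtype.ext (by rw [coe_high, max_eq_left (by linarith)]; rfl)

theorem low_endPres : EndPres low :=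
  ⟨.inl (Subtype.ext (by rw [coe_low]; simp)), .inr (low_eq_one (by norm_num))⟩

theorem high_endPres : EndPres high :=
  ⟨.inl (high_eq_zero (by norm_num)), .inr (Subtype.ext (by rw [coe_high]; norm_num))⟩

theorem symm_endPres : EndPres unitInterval.symm := by simp [EndPres]

end Reparam

section Coord

variable {n : ℕ} {X : Type u} [TopologicalSpace X] [Based X]

/-- Apply a base-point preserving function in the `i`-th smash factor. -/
def Smash.onCoord (i : Fin n) (u : X → X) (hu : u Based.pt = Based.pt) :
    Smash n X → Smash n X :=
  Smash.lift (fun x => Smash.mk (Function.update x i (u (x i)))) Based.pt (by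
    rintro x ⟨j, hj⟩
    refine Smash.mk_eq_pt (i := j) ?_
    by_cases h : j = i
    · subst h; simp [hj, hu]
    · rw [Function.update_of_ne h, hj])

@[simp] theorem Smash.onCoord_mk (i : Fin n) (u : X → X) (hu) (x : Fin n → X) :
    Smash.onCoord i u hu (Smash.mk x) = Smash.mk (Function.update x i (u (x i))) := rfl

theorem Smash.onCoord_pt (i : Fin n) (u : X → X) (hu) :
    Smash.onCoord i u hu (Based.pt : Smash n X) = Based.pt :=
  Smash.mk_eq_pt (i := i) (by simp [hu])

theorem Smash.continuous_onCoord {P : Type} [TopologicalSpace P] [CompactSpace P] [T2Space P]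
    (i : Fin n) (u : P → X → X) (hu : ∀ p, u p Based.pt = Based.pt)
    (hc : Continuous fun q : P × X => u q.1 q.2) :
    Continuous fun q : P × Smash n X => Smash.onCoord i (u q.1) (hu q.1) q.2 := by
  refine Smash.continuous_param (fun p z => Smash.onCoord i (u p) (hu p) z) fun K f => ?_
  have : Continuous fun q : P × K => Function.update (f q.2) i (u q.1 (f q.2 i)) := by
    refine Continuous.update (by fun_prop) i ?_
    exact hc.comp (by fun_prop : Continuous fun q : P × K => (q.1, f q.2 i))
  exact Smash.continuous_mk_comp ⟨_, this⟩

end Coord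

section Add

variable {n : ℕ} {A : Type u} [TopologicalSpace A] [Based A] {W : Type v} [TopologicalSpace W]
  [Based W]

/-- The self map of `(ΣA)^{(n)}` that applies `θ` to the `i`-th suspension coordinate. -/
def PMap.reparam (i : Fin n) (θ : I → I) (h : EndPres θ) (hc : Continuous θ) :
    PMap (Smash n (Susp A)) (Smash n (Susp A)) where
  toMap := ⟨fun z => Smash.onCoord i (Susp.reparam θ h) (Susp.reparam_pt θ h) z, by
    have := Smash.continuous_onCoord (n := n) (X := Susp A) (P := Unit) i
      (fun _ => Susp.reparam θ h) (fun _ => Susp.reparam_pt θ h)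
      (Susp.continuous_reparam (fun _ => θ) (fun _ => h) (by fun_prop))
    exact this.comp (by fun_prop : Continuous fun z : Smash n (Susp A) => ((), z))⟩
  map_pt := Smash.onCoord_pt i (Susp.reparam θ h) (Susp.reparam_pt θ h)

theorem PMap.reparam_mk (i : Fin n) (θ : I → I) (h : EndPres θ) (hc : Continuous θ)
    (x : Fin n → Susp A) : (PMap.reparam i θ h hc).toMap (Smash.mk x) =
      Smash.mk (Function.update x i (Susp.reparam θ h (x i))) := rfl

/-- Reparametrizations that agree at the end points are homotopic. -/
theorem PMap.reparam_homotopic (i : Fin n) {θ θ' : I → I} (h : EndPres θ) (hc : Continuous θ)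
    (h' : EndPres θ') (hc' : Continuous θ') (e0 : θ 0 = θ' 0) (e1 : θ 1 = θ' 1) :
    (PMap.reparam (A := A) i θ h hc).Homotopic (PMap.reparam i θ' h' hc') := by
  let H : I → I → I := fun s t => ⟨(1 - (s : ℝ)) * θ t + s * θ' t, by
    have a := s.2; have b := (θ t).2; have c := (θ' t).2
    simp only [Set.mem_Icc] at a b c ⊢
    constructor <;> nlinarith⟩
  have e : ∀ s t, θ t = θ' t → H s t = θ t := fun s t ht => Subtype.ext (by
    simp only [H, ← ht]; ring)
  have hE : ∀ s, EndPres (H s) := fun s => by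
    unfold EndPres
    rw [e s 0 e0, e s 1 e1]
    exact h
  have hH : Continuous fun q : I × I => H q.1 q.2 := by
    refine Continuous.subtype_mk ?_ _
    fun_prop
  have hz : ∀ t, H 0 t = θ t := fun t => Subtype.ext (by simp [H])
  have ho : ∀ t, H 1 t = θ' t := fun t => Subtype.ext (by simp [H])
  refine PMap.homotopic_of_family _ _ (fun s => Smash.onCoord i (Susp.reparam (H s) (hE s))
    (Susp.reparam_pt _ _)) ?_ ?_ ?_ (fun s => Smash.onCoord_pt _ _ _)
  · exact Smash.continuous_onCoord i (fun s => Susp.reparam (H s) (hE s))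
      (fun s => Susp.reparam_pt _ _) (Susp.continuous_reparam H hE hH)
  · have e0 : H 0 = θ := funext hz
    have : ∀ η (hη : EndPres η), η = θ → ∀ x : Smash n (Susp A),
        Smash.onCoord i (Susp.reparam η hη) (Susp.reparam_pt _ _) x =
          (PMap.reparam i θ h hc).toMap x := by
      rintro η hη rfl x
      rfl
    exact this _ _ e0
  · have e1 : H 1 = θ' := funext ho
    have : ∀ η (hη : EndPres η), η = θ' → ∀ x : Smash n (Susp A),
        Smash.onCoord i (Susp.reparam η hη) (Susp.reparam_pt _ _) x =
          (PMap.reparam i θ' h' hc').toMap x := by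
      rintro η hη rfl x
      rfl
    exact this _ _ e1

/-- The lower half `{[a, t] | t ≤ 1/2}` of the suspension. -/
def Susp.lowHalf (A : Type u) [TopologicalSpace A] [Based A] : Set (Susp A) :=
  {z | ∃ (a : A) (t : I), (t : ℝ) ≤ 1 / 2 ∧ z = Susp.mk a t}

/-- The upper half `{[a, t] | 1/2 ≤ t}` of the suspension. -/
def Susp.highHalf (A : Type u) [TopologicalSpace A] [Based A] : Set (Susp A) :=
  {z | ∃ (a : A) (t : I), 1 / 2 ≤ (t : ℝ) ∧ z = Susp.mk a t}

theorem Susp.mk_mem_lowHalf {a : A} {t : I} :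
    Susp.mk a t ∈ Susp.lowHalf A ↔ (t : ℝ) ≤ 1 / 2 ∨ a = Based.pt ∨ t = 1 := by
  constructor
  · rintro ⟨b, s, hs, h⟩
    rcases Susp.mk_eq_iff.1 h with ⟨-, rfl⟩ | ⟨h1 | h1 | h1, -⟩
    · exact .inl hs
    · exact .inr (.inl h1)
    · left; rw [h1]; norm_num
    · exact .inr (.inr h1)
  · intro h
    by_cases ht : (t : ℝ) ≤ 1 / 2
    · exact ⟨a, t, ht, rfl⟩
    · refine ⟨Based.pt, 0, by norm_num, ?_⟩
      exact Susp.mk_eq_iff.2 (.inr ⟨(h.resolve_left ht).imp_right .inr, .inl rfl⟩)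

theorem Susp.mk_mem_highHalf {a : A} {t : I} :
    Susp.mk a t ∈ Susp.highHalf A ↔ 1 / 2 ≤ (t : ℝ) ∨ a = Based.pt ∨ t = 0 := by
  constructor
  · rintro ⟨b, s, hs, h⟩
    rcases Susp.mk_eq_iff.1 h with ⟨-, rfl⟩ | ⟨h1 | h1 | h1, -⟩
    · exact .inl hs
    · exact .inr (.inl h1)
    · exact .inr (.inr h1)
    · left; rw [h1]; norm_num
  · intro h
    by_cases ht : 1 / 2 ≤ (t : ℝ)
    · exact ⟨a, t, ht, rfl⟩
    · refine ⟨Based.pt, 1, by norm_num, ?_⟩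
      exact Susp.mk_eq_iff.2 (.inr ⟨(h.resolve_left ht).imp_right .inl, .inl rfl⟩)

theorem Susp.isClosed_lowHalf [T1Space A] : IsClosed (Susp.lowHalf A) := by
  have hq : Topology.IsQuotientMap (Quotient.mk (collapse (suspBase A))) :=
    isQuotientMap_quotient_mk'
  refine hq.isClosed_preimage.1 ?_
  have : Quotient.mk (collapse (suspBase A)) ⁻¹' Susp.lowHalf A =
      {q : A × I | (q.2 : ℝ) ≤ 1 / 2} ∪ ({q | q.1 = Based.pt} ∪ {q | q.2 = 1}) :=
    Set.ext fun q => Susp.mk_mem_lowHalf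
  rw [this]
  exact (isClosed_le (by fun_prop) (by fun_prop)).union
    ((isClosed_singleton.preimage continuous_fst).union
      (isClosed_eq continuous_snd continuous_const))

theorem Susp.isClosed_highHalf [T1Space A] : IsClosed (Susp.highHalf A) := by
  have hq : Topology.IsQuotientMap (Quotient.mk (collapse (suspBase A))) :=
    isQuotientMap_quotient_mk'
  refine hq.isClosed_preimage.1 ?_
  have : Quotient.mk (collapse (suspBase A)) ⁻¹' Susp.highHalf A =
      {q : A × I | 1 / 2 ≤ (q.2 : ℝ)} ∪ ({q | q.1 = Based.pt} ∪ {q | q.2 = 0}) :=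
    Set.ext fun q => Susp.mk_mem_highHalf
  rw [this]
  exact (isClosed_le (by fun_prop) (by fun_prop)).union
    ((isClosed_singleton.preimage continuous_fst).union
      (isClosed_eq continuous_snd continuous_const))

theorem Susp.lowHalf_or_highHalf (z : Susp A) : z ∈ Susp.lowHalf A ∨ z ∈ Susp.highHalf A := by
  induction z using Susp.ind with
  | h a t => exact (le_total (t : ℝ) (1 / 2)).imp (fun h => ⟨a, t, h, rfl⟩) fun h => ⟨a, t, h, rfl⟩

open Classical in
/-- The co-`H` sum of two functions on `(ΣA)^{(n)}`, formed with the `i`-th suspension coordinate: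
`F` is used, at double speed, on the lower half and `G` on the upper half. See `addFun_mk` for
the formula. -/
def addFun (i : Fin n) (F G : Smash n (Susp A) → W) (hF : F Based.pt = Based.pt)
    (hG : G Based.pt = Based.pt) : Smash n (Susp A) → W :=
  Smash.lift (fun x => if x i ∈ Susp.lowHalf A
      then F (Smash.mk (Function.update x i (Susp.reparam low low_endPres (x i))))
      else G (Smash.mk (Function.update x i (Susp.reparam high high_endPres (x i)))))
    Based.pt (by
      rintro x ⟨j, hj⟩
      have key : ∀ θ h, (Smash.mk (Function.update x i (Susp.reparam θ h (x i))) :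
          Smash n (Susp A)) = Based.pt := fun θ h => by
        change Smash.onCoord i (Susp.reparam θ h) (Susp.reparam_pt θ h) (Smash.mk x) = _
        rw [Smash.mk_eq_pt hj, Smash.onCoord_pt]
      rw [key, key, hF, hG, ite_self])

theorem addFun_mk (i : Fin n) (F G : Smash n (Susp A) → W) (hF : F Based.pt = Based.pt)
    (hG : G Based.pt = Based.pt) (x : Fin n → Susp A) (a : A) (t : I) (hx : x i = Susp.mk a t) :
    addFun i F G hF hG (Smash.mk x) = if (t : ℝ) ≤ 1 / 2
      then F (Smash.mk (Function.update x i (Susp.mk a (low t))))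
      else G (Smash.mk (Function.update x i (Susp.mk a (high t)))) := by
  classical
  have hb : ∀ z : Susp A, z = Based.pt → (Smash.mk (Function.update x i z) : Smash n (Susp A)) =
      Based.pt := fun z hz => Smash.mk_eq_pt (i := i) (by simp [hz])
  unfold addFun
  rw [Smash.lift_mk]
  simp only [hx, Susp.reparam_mk, Susp.mk_mem_lowHalf]
  by_cases ht : (t : ℝ) ≤ 1 / 2
  · rw [if_pos (.inl ht), if_pos ht]
  · by_cases hp : a = Based.pt ∨ t = 1
    · rw [if_pos (.inr hp), if_neg ht, hb, hb, hF, hG]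
      · rcases hp with rfl | rfl
        · exact Susp.mk_eq_pt.2 (.inl rfl)
        · exact Susp.mk_eq_pt.2 (.inr high_endPres.2)
      · rcases hp with rfl | rfl
        · exact Susp.mk_eq_pt.2 (.inl rfl)
        · exact Susp.mk_eq_pt.2 (.inr low_endPres.2)
    · rw [if_neg (by tauto), if_neg ht]

theorem addFun_pt (i : Fin n) (F G : Smash n (Susp A) → W) (hF : F Based.pt = Based.pt)
    (hG : G Based.pt = Based.pt) : addFun i F G hF hG Based.pt = Based.pt := by
  have : (Smash.mk fun _ => (Based.pt : Susp A) : Smash n (Susp A)) = Based.pt := rfl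
  rw [← this, addFun_mk i F G hF hG _ Based.pt 0 rfl, if_pos (by norm_num),
    Smash.mk_eq_pt (i := i) (by simpa using Susp.mk_eq_pt.2 (.inl rfl)), hF]

theorem continuous_addFun [T1Space A] {P : Type} [TopologicalSpace P] [CompactSpace P] [T2Space P]
    (i : Fin n) (F G : P → Smash n (Susp A) → W) (hF : ∀ p, F p Based.pt = Based.pt)
    (hG : ∀ p, G p Based.pt = Based.pt) (cF : Continuous fun q : P × Smash n (Susp A) => F q.1 q.2)
    (cG : Continuous fun q : P × Smash n (Susp A) => G q.1 q.2) :
    Continuous fun q : P × Smash n (Susp A) => addFun i (F q.1) (G q.1) (hF q.1) (hG q.1) q.2 := by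
  classical
  refine Smash.continuous_param (fun p z => addFun i (F p) (G p) (hF p) (hG p) z) fun K f => ?_
  have hm : ∀ θ (h : EndPres θ), Continuous θ → Continuous fun q : P × K =>
      (Smash.mk (Function.update (f q.2) i (Susp.reparam θ h (f q.2 i))) : Smash n (Susp A)) := by
    intro θ h hc
    have h2 : Continuous fun q : P × K => (Smash.mk (f q.2) : Smash n (Susp A)) :=
      (Smash.continuous_mk_comp f).comp continuous_snd
    exact (PMap.reparam i θ h hc).toMap.continuous.comp h2
  have ev : Continuous fun q : P × K => f q.2 i := by fun_prop
  refine Continuous.if (p := fun q : P × K => f q.2 i ∈ Susp.lowHalf A) ?_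
    (cF.comp (continuous_fst.prodMk (hm low low_endPres continuous_low)))
    (cG.comp (continuous_fst.prodMk (hm high high_endPres continuous_high)))
  intro q hq
  have hl : f q.2 i ∈ Susp.lowHalf A :=
    (Susp.isClosed_lowHalf.preimage ev).frontier_subset hq
  have hh : f q.2 i ∈ Susp.highHalf A := by
    rw [← frontier_compl] at hq
    refine (closure_minimal (t := (fun q : P × K => f q.2 i) ⁻¹' Susp.highHalf A) ?_
      (Susp.isClosed_highHalf.preimage ev)) (frontier_subset_closure hq)
    exact fun q hq => (Susp.lowHalf_or_highHalf _).resolve_left hq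
  have hb : ∀ z : Susp A, z = Based.pt →
      (Smash.mk (Function.update (f q.2) i z) : Smash n (Susp A)) =
      Based.pt := fun z hz => Smash.mk_eq_pt (i := i) (by simp [hz])
  change F q.1 (Smash.mk (Function.update (f q.2) i (Susp.reparam low low_endPres (f q.2 i)))) =
    G q.1 (Smash.mk (Function.update (f q.2) i (Susp.reparam high high_endPres (f q.2 i))))
  rw [hb, hb, hF, hG]
  all_goals
    revert hl hh
    generalize f q.2 i = z
    induction z using Susp.ind with
    | h a t =>
      rw [Susp.mk_mem_lowHalf, Susp.mk_mem_highHalf, Susp.reparam_mk, Susp.mk_eq_pt]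
      rintro (h1 | rfl | rfl) (h2 | h2 | h2)
      all_goals try subst h2
      all_goals first
        | exact absurd h2 one_ne_zero
        | exact .inl rfl
        | exact .inl h2
        | exact .inr low_endPres.1
        | exact .inr low_endPres.2
        | exact .inr high_endPres.1
        | exact .inr high_endPres.2
        | exact .inr (.inr (low_eq_one h2))
        | exact .inr (.inl (high_eq_zero h1))

/-- The sum of two maps `(ΣA)^{(n)} → W`, formed with the `i`-th suspension coordinate. -/
def PMap.addAt [T1Space A] (i : Fin n) (f g : PMap (Smash n (Susp A)) W) :
    PMap (Smash n (Susp A)) W where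
  toMap := ⟨fun z => addFun i f.toMap g.toMap f.map_pt g.map_pt z, by
    have := continuous_addFun (P := Unit) i (fun _ => f.toMap) (fun _ => g.toMap)
      (fun _ => f.map_pt) (fun _ => g.map_pt) (by fun_prop) (by fun_prop)
    exact this.comp (by fun_prop : Continuous fun z : Smash n (Susp A) => ((), z))⟩
  map_pt := addFun_pt i f.toMap g.toMap f.map_pt g.map_pt

theorem PMap.addAt_mk [T1Space A] (i : Fin n) (f g : PMap (Smash n (Susp A)) W)
    (x : Fin n → Susp A) (a : A) (t : I) (hx : x i = Susp.mk a t) :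
    (PMap.addAt i f g).toMap (Smash.mk x) = if (t : ℝ) ≤ 1 / 2
      then f.toMap (Smash.mk (Function.update x i (Susp.mk a (low t))))
      else g.toMap (Smash.mk (Function.update x i (Susp.mk a (high t)))) :=
  addFun_mk i f.toMap g.toMap f.map_pt g.map_pt x a t hx

theorem PMap.addAt_homotopic [T1Space A] (i : Fin n) {f f' g g' : PMap (Smash n (Susp A)) W}
    (hf : f.Homotopic f') (hg : g.Homotopic g') :
    (PMap.addAt i f g).Homotopic (PMap.addAt i f' g') := by
  obtain ⟨F, cF, F0, F1, Fp⟩ := hf.family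
  obtain ⟨G, cG, G0, G1, Gp⟩ := hg.family
  refine PMap.homotopic_of_family _ _ (fun s => addFun i (F s) (G s) (Fp s) (Gp s))
    (continuous_addFun i F G Fp Gp cF cG) ?_ ?_ (fun s => addFun_pt _ _ _ _ _)
  · have a : F 0 = f.toMap := funext F0
    have b : G 0 = g.toMap := funext G0
    have : ∀ (F G : Smash n (Susp A) → W) (hF : F Based.pt = Based.pt)
        (hG : G Based.pt = Based.pt), F = f.toMap → G = g.toMap →
        ∀ x, addFun i F G hF hG x = (PMap.addAt i f g).toMap x := by
      rintro _ _ hF hG rfl rfl x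
      rfl
    exact this _ _ _ _ a b
  · have a : F 1 = f'.toMap := funext F1
    have b : G 1 = g'.toMap := funext G1
    have : ∀ (F G : Smash n (Susp A) → W) (hF : F Based.pt = Based.pt)
        (hG : G Based.pt = Based.pt), F = f'.toMap → G = g'.toMap →
        ∀ x, addFun i F G hF hG x = (PMap.addAt i f' g').toMap x := by
      rintro _ _ hF hG rfl rfl x
      rfl
    exact this _ _ _ _ a b

/-- The inverse of a map `(ΣA)^{(n)} → W`: the `i`-th suspension coordinate is reversed. -/
def PMap.negAt (i : Fin n) (f : PMap (Smash n (Susp A)) W) : PMap (Smash n (Susp A)) W :=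
  f.comp (PMap.reparam i unitInterval.symm symm_endPres unitInterval.continuous_symm)

theorem PMap.comp_homotopic {X : Type u} {Y : Type v} {Z : Type w} [TopologicalSpace X] [Based X]
    [TopologicalSpace Y] [Based Y] [TopologicalSpace Z] [Based Z] {g g' : PMap Y Z}
    {f f' : PMap X Y} (hg : g.Homotopic g') (hf : f.Homotopic f') :
    (g.comp f).Homotopic (g'.comp f') := by
  obtain ⟨F, cF, F0, F1, Fp⟩ := hf.family
  obtain ⟨G, cG, G0, G1, Gp⟩ := hg.family
  refine PMap.homotopic_of_family _ _ (fun s x => G s (F s x)) ?_ ?_ ?_ ?_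
  · exact cG.comp (continuous_fst.prodMk cF)
  · intro x; rw [F0, G0]; rfl
  · intro x; rw [F1, G1]; rfl
  · intro s; rw [Fp, Gp]

theorem PMap.comp_reparam_homotopic (f : PMap (Smash n (Susp A)) W)
    (i : Fin n) {θ θ' : I → I} (h : EndPres θ) (hc : Continuous θ)
    (h' : EndPres θ') (hc' : Continuous θ') (e0 : θ 0 = θ' 0) (e1 : θ 1 = θ' 1) :
    (f.comp (PMap.reparam i θ h hc)).Homotopic (f.comp (PMap.reparam i θ' h' hc')) :=
  PMap.comp_homotopic (.refl _) (PMap.reparam_homotopic i h hc h' hc' e0 e1)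

theorem PMap.comp_reparam_mk (f : PMap (Smash n (Susp A)) W) (i : Fin n) {θ : I → I}
    (h : EndPres θ) (hc : Continuous θ) (x : Fin n → Susp A) (a : A) (t : I)
    (hx : x i = Susp.mk a t) : (f.comp (PMap.reparam i θ h hc)).toMap (Smash.mk x) =
      f.toMap (Smash.mk (Function.update x i (Susp.mk a (θ t)))) := by
  change f.toMap ((PMap.reparam i θ h hc).toMap (Smash.mk x)) = _
  rw [PMap.reparam_mk, hx, Susp.reparam_mk]

theorem id_endPres : EndPres (fun t => t) := by simp [EndPres]

theorem PMap.comp_reparam_id (f : PMap (Smash n (Susp A)) W) (i : Fin n) :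
    f.comp (PMap.reparam i (fun t => t) id_endPres continuous_id) = f := by
  refine PMap.ext_apply (Smash.ind fun x => ?_)
  obtain ⟨⟨a, t⟩, h⟩ := Quotient.exists_rep (x i)
  rw [PMap.comp_reparam_mk f i _ _ x a t h.symm]
  congr 2
  exact Function.update_eq_self_iff.2 h

theorem mk_update_pt (i : Fin n) (x : Fin n → Susp A) {z : Susp A} (h : z = Based.pt) :
    (Smash.mk (Function.update x i z) : Smash n (Susp A)) = Based.pt :=
  Smash.mk_eq_pt (i := i) (by simp [h])

/-- Two maps agree if they agree on points with given `i`-th suspension coordinate. -/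
theorem PMap.ext_coord (i : Fin n) {f g : PMap (Smash n (Susp A)) W}
    (h : ∀ (x : Fin n → Susp A) a t, x i = Susp.mk a t →
      f.toMap (Smash.mk x) = g.toMap (Smash.mk x)) : f = g := by
  refine PMap.ext_apply (Smash.ind fun x => ?_)
  obtain ⟨⟨a, t⟩, e⟩ := Quotient.exists_rep (x i)
  exact h x a t e.symm

theorem PMap.zero_addAt [T1Space A] (i : Fin n) (f : PMap (Smash n (Susp A)) W) :
    (PMap.addAt i (PMap.const _ _) f).Homotopic f := by
  have e : PMap.addAt i (PMap.const _ _) f =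
      f.comp (PMap.reparam i high high_endPres continuous_high) := by
    refine PMap.ext_coord i fun x a t hx => ?_
    rw [PMap.addAt_mk i _ _ x a t hx, PMap.comp_reparam_mk f i _ _ x a t hx]
    split_ifs with h
    · rw [high_eq_zero h, mk_update_pt i x (Susp.mk_eq_pt.2 (.inr (.inl rfl))), f.map_pt]
      rfl
    · rfl
  rw [e]
  conv => rhs; rw [← PMap.comp_reparam_id f i]
  exact PMap.comp_reparam_homotopic f i _ _ _ _ (high_eq_zero (by norm_num))
    (Subtype.ext (by rw [coe_high]; norm_num))

theorem PMap.addAt_zero [T1Space A] (i : Fin n) (f : PMap (Smash n (Susp A)) W) :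
    (PMap.addAt i f (PMap.const _ _)).Homotopic f := by
  have e : PMap.addAt i f (PMap.const _ _) =
      f.comp (PMap.reparam i low low_endPres continuous_low) := by
    refine PMap.ext_coord i fun x a t hx => ?_
    rw [PMap.addAt_mk i _ _ x a t hx, PMap.comp_reparam_mk f i _ _ x a t hx]
    split_ifs with h
    · rfl
    · rw [low_eq_one (by linarith), mk_update_pt i x (Susp.mk_eq_pt.2 (.inr (.inr rfl))), f.map_pt]
      rfl
  rw [e]
  conv => rhs; rw [← PMap.comp_reparam_id f i]
  exact PMap.comp_reparam_homotopic f i _ _ _ _ (Subtype.ext (by rw [coe_low]; simp))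
    (low_eq_one (by norm_num))

theorem PMap.neg_addAt [T1Space A] (i : Fin n) (f : PMap (Smash n (Susp A)) W) :
    (PMap.addAt i (PMap.negAt i f) f).Homotopic (PMap.const _ _) := by
  let V : I → I := fun t => ⟨|2 * (t : ℝ) - 1|, abs_nonneg _, by
    have := t.2.1; have := t.2.2; rw [abs_le]; constructor <;> linarith⟩
  have hV : Continuous V := by
    refine Continuous.subtype_mk ?_ _
    fun_prop
  have V0 : V 0 = 1 := Subtype.ext (by simp [V])
  have V1 : V 1 = 1 := Subtype.ext (by simp [V]; norm_num)
  have hE : EndPres V := ⟨.inr V0, .inr V1⟩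
  have e : PMap.addAt i (PMap.negAt i f) f = f.comp (PMap.reparam i V hE hV) := by
    refine PMap.ext_coord i fun x a t hx => ?_
    rw [PMap.addAt_mk i _ _ x a t hx, PMap.comp_reparam_mk f i _ _ x a t hx]
    split_ifs with h
    · rw [PMap.negAt, PMap.comp_reparam_mk f i _ _ _ a (low t) (by simp), Function.update_idem]
      congr 4
      refine Subtype.ext ?_
      simp only [unitInterval.coe_symm_eq, coe_low, V]
      rw [min_eq_right (by linarith), abs_of_nonpos (by linarith)]
      ring
    · congr 4
      refine Subtype.ext ?_
      simp only [coe_high, V]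
      rw [max_eq_right (by linarith), abs_of_nonneg (by linarith)]
  have hone : EndPres (fun _ => 1) := ⟨.inr rfl, .inr rfl⟩
  have e' : PMap.const _ _ = f.comp (PMap.reparam i (fun _ => 1) hone continuous_const) := by
    refine PMap.ext_coord i fun x a t hx => ?_
    rw [PMap.comp_reparam_mk f i hone continuous_const x a t hx,
      mk_update_pt i x (Susp.mk_eq_pt.2 (.inr (.inr rfl))), f.map_pt]
    rfl
  rw [e, e']
  exact PMap.comp_reparam_homotopic f i _ _ _ _ V0 V1

theorem PMap.addAt_assoc [T1Space A] (i : Fin n) (f g h : PMap (Smash n (Susp A)) W) :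
    (PMap.addAt i (PMap.addAt i f g) h).Homotopic (PMap.addAt i f (PMap.addAt i g h)) := by
  let θ : I → I := fun t => ⟨min (2 * (t : ℝ)) (min (t + 1 / 4) ((t + 1) / 2)), by
    have a := t.2.1
    have b := t.2.2
    refine ⟨le_min (by linarith) (le_min (by linarith) (by linarith)), ?_⟩
    exact (min_le_right _ _).trans ((min_le_right _ _).trans (by linarith))⟩
  have hc : Continuous θ := by
    refine Continuous.subtype_mk ?_ _
    fun_prop
  have θ0 : θ 0 = 0 := Subtype.ext (by simp [θ])
  have θ1 : θ 1 = 1 := Subtype.ext (by simp [θ])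
  have hE : EndPres θ := ⟨.inl θ0, .inr θ1⟩
  have e : PMap.addAt i (PMap.addAt i f g) h =
      (PMap.addAt i f (PMap.addAt i g h)).comp (PMap.reparam i θ hE hc) := by
    refine PMap.ext_coord i fun x a t hx => ?_
    rw [PMap.comp_reparam_mk _ i _ _ x a t hx, PMap.addAt_mk i _ _ x a t hx,
      PMap.addAt_mk i _ _ _ a (low t) (by simp), PMap.addAt_mk i _ _ _ a (θ t) (by simp),
      PMap.addAt_mk i _ _ _ a (high (θ t)) (by simp)]
    simp only [Function.update_idem]
    have l1 := coe_low t
    have l2 := coe_low (low t)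
    have l3 := coe_high (low t)
    have l4 := coe_high t
    have l5 := coe_low (θ t)
    have l6 := coe_high (θ t)
    have l7 := coe_low (high (θ t))
    have l8 := coe_high (high (θ t))
    have l0 : (θ t : ℝ) = min (2 * (t : ℝ)) (min (t + 1 / 4) ((t + 1) / 2)) := rfl
    have t0 := t.2.1
    have t1 := t.2.2
    rcases le_or_gt (t : ℝ) (1 / 4) with c1 | c1
    · have q0 : (θ t : ℝ) = 2 * t := by
        rw [l0, min_eq_left (le_min (by linarith) (by linarith))]
      have q1 : (low t : ℝ) = 2 * t := by rw [l1, min_eq_right (by linarith)]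
      rw [if_pos (by linarith), if_pos (by rw [q1]; linarith), if_pos (by rw [q0]; linarith)]
      have : low t = θ t := Subtype.ext (by rw [q0, q1])
      rw [this]
    · rcases le_or_gt (t : ℝ) (1 / 2) with c2 | c2
      · have q0 : (θ t : ℝ) = t + 1 / 4 := by
          rw [l0, min_eq_left (a := (t : ℝ) + 1 / 4) (by linarith), min_eq_right (by linarith)]
        have q1 : (low t : ℝ) = 2 * t := by rw [l1, min_eq_right (by linarith)]
        have q6 : (high (θ t) : ℝ) = 2 * (t + 1 / 4) - 1 := by
          rw [l6, q0, max_eq_right (by linarith)]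
        rw [if_pos c2, if_neg (by rw [q1]; linarith), if_neg (by rw [q0]; linarith),
          if_pos (by rw [q6]; linarith)]
        have : high (low t) = low (high (θ t)) := Subtype.ext (by
          rw [l3, l7, q1, q6, max_eq_right (by linarith), min_eq_right (by linarith)]
          ring)
        rw [this]
      · have q0 : (θ t : ℝ) = (t + 1) / 2 := by
          rw [l0, min_eq_right (a := (t : ℝ) + 1 / 4) (by linarith), min_eq_right (by linarith)]
        have q6 : (high (θ t) : ℝ) = t := by
          rw [l6, q0, max_eq_right (by linarith)]
          ring
        rw [if_neg (by linarith), if_neg (by rw [q0]; linarith), if_neg (by rw [q6]; linarith)]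
        have : high t = high (high (θ t)) := Subtype.ext (by rw [l4, l8, q6])
        rw [this]
  rw [e]
  conv => rhs; rw [← PMap.comp_reparam_id (PMap.addAt i f (PMap.addAt i g h)) i]
  exact PMap.comp_reparam_homotopic _ i _ _ _ _ θ0 θ1

/-- The interchange law for the sums formed with two different suspension coordinates. -/
theorem PMap.addAt_interchange [T1Space A] {i j : Fin n} (hij : i ≠ j)
    (f g h k : PMap (Smash n (Susp A)) W) :
    PMap.addAt i (PMap.addAt j f g) (PMap.addAt j h k) =
      PMap.addAt j (PMap.addAt i f h) (PMap.addAt i g k) := by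
  refine PMap.ext_coord i fun x a t hx => ?_
  obtain ⟨⟨b, s⟩, hy⟩ := Quotient.exists_rep (x j)
  have hy : x j = Susp.mk b s := hy.symm
  rw [PMap.addAt_mk i _ _ x a t hx, PMap.addAt_mk j _ _ x b s hy,
    PMap.addAt_mk j _ _ _ b s (by rw [Function.update_of_ne hij.symm, hy]),
    PMap.addAt_mk j _ _ _ b s (by rw [Function.update_of_ne hij.symm, hy]),
    PMap.addAt_mk i _ _ _ a t (by rw [Function.update_of_ne hij, hx]),
    PMap.addAt_mk i _ _ _ a t (by rw [Function.update_of_ne hij, hx])]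
  simp only [Function.update_comm hij]
  split_ifs <;> rfl

end Add

section Group

variable {n : ℕ} {A : Type u} [TopologicalSpace A] [Based A] [T1Space A] {W : Type v}
  [TopologicalSpace W] [Based W]

/-- The sum of homotopy classes formed with the `i`-th suspension coordinate. -/
def HClass.addAt (i : Fin n) : HClass (Smash n (Susp A)) W → HClass (Smash n (Susp A)) W →
    HClass (Smash n (Susp A)) W :=
  Quotient.map₂ (PMap.addAt i) fun _ _ h _ _ k => PMap.addAt_homotopic i h k

/-- The group structure on `[(ΣA)^{(n)}, W]`, `n ≥ 1`, given by the co-`H` structure of the first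
suspension coordinate. -/
instance HClass.addGroup [NeZero n] : AddGroup (HClass (Smash n (Susp A)) W) :=
  letI : Add (HClass (Smash n (Susp A)) W) := ⟨HClass.addAt 0⟩
  letI : Zero (HClass (Smash n (Susp A)) W) := ⟨PMap.cls (PMap.const _ _)⟩
  letI : Neg (HClass (Smash n (Susp A)) W) := ⟨Quotient.map (PMap.negAt 0)
    fun _ _ h => PMap.comp_homotopic h (.refl _)⟩
  AddGroup.ofLeftAxioms
    (fun a b c => Quotient.inductionOn₃ a b c fun f g h => Quotient.sound (PMap.addAt_assoc 0 f g h))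
    (fun a => Quotient.inductionOn a fun f => Quotient.sound (PMap.zero_addAt 0 f))
    (fun a => Quotient.inductionOn a fun f => Quotient.sound (PMap.neg_addAt 0 f))

theorem HClass.cls_add [NeZero n] (f g : PMap (Smash n (Susp A)) W) :
    f.cls + g.cls = (PMap.addAt 0 f g).cls := rfl

/-- For `n ≥ 2` the group `[(ΣA)^{(n)}, W]` is abelian. -/
theorem HClass.add_comm_of_two_le [NeZero n] (hn : 2 ≤ n)
    (a b : HClass (Smash n (Susp A)) W) : a + b = b + a := by
  have hu : ∀ i : Fin n, EckmannHilton.IsUnital (HClass.addAt (A := A) (W := W) i)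
      (PMap.cls (PMap.const _ _)) := fun i =>
    { left_id := fun a => Quotient.inductionOn a fun f => Quotient.sound (PMap.zero_addAt i f)
      right_id := fun a => Quotient.inductionOn a fun f => Quotient.sound (PMap.addAt_zero i f) }
  have hij : (0 : Fin n) ≠ ⟨1, hn⟩ := by
    intro h
    have := congrArg Fin.val h
    simp at this
  have hd : ∀ a b c d : HClass (Smash n (Susp A)) W,
      HClass.addAt ⟨1, hn⟩ (HClass.addAt 0 a b) (HClass.addAt 0 c d) =
        HClass.addAt 0 (HClass.addAt ⟨1, hn⟩ a c) (HClass.addAt ⟨1, hn⟩ b d) := by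
    intro a b c d
    refine Quotient.inductionOn₂ a b (fun f g => Quotient.inductionOn₂ c d (fun h k => ?_))
    exact congrArg PMap.cls (PMap.addAt_interchange hij.symm f g h k)
  exact (EckmannHilton.mul_comm (hu ⟨1, hn⟩) (hu 0) hd).comm a b

end Group

/-! ### Permutations and the action of the group ring -/

section Perm

variable {n : ℕ} {X : Type u} [TopologicalSpace X] [Based X]

/-- The action of a permutation on `X^{(n)}` by permuting positions: the `i`-th factor is moved to
position `τ i`. -/
def permMap (τ : Equiv.Perm (Fin n)) : PMap (Smash n X) (Smash n X) where
  toMap := ⟨Smash.lift (fun x => Smash.mk fun i => x (τ.symm i)) Based.pt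
      (fun x ⟨i, hi⟩ => Smash.mk_eq_pt (i := τ i) (by simpa using hi)), by
    rw [Smash.continuous_iff]
    intro K f
    exact Smash.continuous_mk_comp ⟨fun k i => f k (τ.symm i), by fun_prop⟩⟩
  map_pt := rfl

/-- The sum `∑_τ c τ` over all permutations, in an additive group. (All sums below take place in
`[(ΣA)^{(n)}, (ΣA)^{(n)}]`, where the order of the summands is immaterial: for `n = 1` there is
one summand, and for `n ≥ 2` the group is abelian.) -/
def permSum {G : Type v} [AddGroup G] (c : Equiv.Perm (Fin n) → G) : G :=
  ((Finset.univ : Finset (Equiv.Perm (Fin n))).toList.map c).sum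

/-- The trace map `φ_n = ∑_τ τ`, as an element of the group `[X^{(n)}, X^{(n)}]` for `X = ΣA`. -/
def traceClass (n : ℕ) [NeZero n] (A : Type u) [TopologicalSpace A] [Based A] [T1Space A] :
    HClass (Smash n (Susp A)) (Smash n (Susp A)) :=
  permSum fun τ : Equiv.Perm (Fin n) => (permMap τ).cls

end Perm

instance primeIdeal (p : ℕ) [Fact p.Prime] : (Ideal.span {(p : ℤ)}).IsPrime :=
  (Ideal.span_singleton_prime (by exact_mod_cast (Fact.out : p.Prime).ne_zero)).2
    (Nat.prime_iff_prime_int.1 Fact.out)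

/-- The ring `ℤ_(p)` of integers localized at the prime `p`. -/
abbrev ZLoc (p : ℕ) [Fact p.Prime] : Type := Localization.AtPrime (Ideal.span {(p : ℤ)})

/-- The class `c` in `[X^{(n)}, X^{(n)}]`, `X = ΣA`, is `∑_τ k_τ τ` where `∑_τ k_τ τ = e` is a
given element of the group ring `ℤ_(p)(Σ_n)`: for some common denominator `N` of the coefficients,
`N c = ∑_τ (N k_τ) τ`. -/
def Represents (p : ℕ) [Fact p.Prime] {n : ℕ} [NeZero n] {A : Type u} [TopologicalSpace A]
    [Based A] [T1Space A] (e : MonoidAlgebra (ZLoc p) (Equiv.Perm (Fin n)))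
    (c : HClass (Smash n (Susp A)) (Smash n (Susp A))) : Prop :=
  ∃ (N : ℕ) (k : Equiv.Perm (Fin n) → ℤ), ¬ p ∣ N ∧
    (∀ τ, (N : ZLoc p) * e.coeff τ = (k τ : ZLoc p)) ∧
    N • c = permSum fun τ : Equiv.Perm (Fin n) => k τ • (permMap τ).cls

/-- A simply connected space is `p`-local if all its homotopy groups are `ℤ_(p)`-modules, that is,
uniquely divisible by all primes different from `p`. -/
def IsPLocal (p : ℕ) (X : Type u) [TopologicalSpace X] [Based X] : Prop :=
  SimplyConnectedSpace X ∧ ∀ (m q : ℕ), q.Prime → q ≠ p →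
    Function.Bijective fun g : HomotopyGroup (Fin (m + 1)) X Based.pt => g ^ q

/-! ### Functorial retracts of the tensor power functor -/

/-- A functorial retract of the functor `V ↦ V^{⊗n}` on `R`-modules, given by a natural idempotent
(the retract being its image). -/
structure FunctorialRetract (R : Type u) [CommRing R] (n : ℕ) where
  proj : ∀ (V : Type u) [AddCommGroup V] [Module R V],
    (⨂[R] _ : Fin n, V) →ₗ[R] (⨂[R] _ : Fin n, V)
  natural : ∀ (V V' : Type u) [AddCommGroup V] [Module R V] [AddCommGroup V'] [Module R V']
    (f : V →ₗ[R] V'), (PiTensorProduct.map fun _ : Fin n => f) ∘ₗ proj V =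
      proj V' ∘ₗ (PiTensorProduct.map fun _ : Fin n => f)
  idem : ∀ (V : Type u) [AddCommGroup V] [Module R V], proj V ∘ₗ proj V = proj V

namespace FunctorialRetract

variable {R : Type u} [CommRing R] {n : ℕ}

/-- The retract contains the bottom cell: it contains all the elements `v ⊗ ⋯ ⊗ v`. -/
def ContainsBottomCell (M : FunctorialRetract R n) : Prop :=
  ∀ (V : Type u) [AddCommGroup V] [Module R V] (v : V),
    M.proj V (PiTensorProduct.tprod R fun _ : Fin n => v) =
      PiTensorProduct.tprod R fun _ : Fin n => v

/-- `M` is a functorial retract of `M'`, compatibly with the projections from `V^{⊗n}`. -/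
def IsRetractOf (M M' : FunctorialRetract R n) : Prop :=
  ∀ (V : Type u) [AddCommGroup V] [Module R V],
    M.proj V ∘ₗ M'.proj V = M.proj V ∧ M'.proj V ∘ₗ M.proj V = M.proj V

/-- `M` is a smallest functorial retract that contains the bottom cell: it contains the bottom
cell, and no proper functorial retract of it does. -/
def IsSmallest (M : FunctorialRetract R n) : Prop :=
  M.ContainsBottomCell ∧ ∀ M' : FunctorialRetract R n,
    M'.ContainsBottomCell → M'.IsRetractOf M → M.IsRetractOf M'

/-- The natural idempotent of `M` is given by the element `e` of the group ring, which acts on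
`V^{⊗n}` by permuting positions. -/
def IsInducedBy (M : FunctorialRetract R n) (e : MonoidAlgebra R (Equiv.Perm (Fin n))) : Prop :=
  ∀ (V : Type u) [AddCommGroup V] [Module R V],
    M.proj V = ∑ τ : Equiv.Perm (Fin n),
      e.coeff τ • (PiTensorProduct.reindex R (fun _ : Fin n => V) τ).toLinearMap

end FunctorialRetract

/-! ### Homotopy colimits -/

section Telescope

variable {Y : Type u} [TopologicalSpace Y] [Based Y]

/-- The identifications of the reduced mapping telescope. -/
inductive TelescopeRel (f : PMap Y Y) : ℕ × I × Y → ℕ × I × Y → Prop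
  | glue (k : ℕ) (y : Y) : TelescopeRel f (k, 1, y) (k + 1, 0, f.toMap y)
  | base (k : ℕ) (t : I) : TelescopeRel f (k, t, Based.pt) (0, 0, Based.pt)

/-- The homotopy colimit `hocolim_f Y` of the sequence `Y → Y → Y → ⋯` all of whose maps are `f`:
the reduced mapping telescope. -/
def Hocolim (f : PMap Y Y) : Type u := Quot (TelescopeRel f)

instance (f : PMap Y Y) : TopologicalSpace (Hocolim f) :=
  inferInstanceAs (TopologicalSpace (Quot (TelescopeRel f)))

instance (f : PMap Y Y) : Based (Hocolim f) := ⟨Quot.mk _ (0, 0, Based.pt)⟩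

/-- The canonical map from the first term of the sequence to the homotopy colimit. -/
def Hocolim.incl (f : PMap Y Y) : PMap Y (Hocolim f) where
  toMap := ⟨fun y => Quot.mk (TelescopeRel f) (0, 0, y),
    continuous_quot_mk.comp (by fun_prop : Continuous fun y : Y => ((0 : ℕ), (0 : I), y))⟩
  map_pt := rfl

end Telescope

end LabelTrace

end

/-! On the loop space of a simply connected space with uniquely `N`-divisible homotopy groups, the
path fibration of the `N`-th power map has weakly contractible fibres, so maps and homotopies from
a CW complex lift along the power map. By adjunction the self map of degree `N` of a `p`-local
suspension `ΣA` is a homotopy equivalence when `N` is prime to `p`, and multiplication by `N` on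
`[(ΣA)^{(n)}, W]`, which is induced by that self map of one smash factor, is bijective. Hence every
element of the group ring represents a unique class. A natural idempotent of `V ↦ V^{⊗n}` that fixes
the bottom cell is given by an element of augmentation one, and the trace absorbs every such element
because it absorbs permutations. A map `φ` that is homotopic to `φ ∘ a` extends over the telescope
of `a`, with that homotopy on each cylinder. -/

noncomputable section

open scoped unitInterval TensorProduct

namespace LabelTrace

universe u v w

/-! ### Natural endomorphisms of the tensor power functor -/

section NaturalEndomorphisms

variable {R : Type u} [CommRing R] {n : ℕ}

/-- Naturality of a family of endomorphisms of the tensor powers `V^{⊗n}`, for all `R`-modules `V`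
in one universe. -/
def IsNaturalTensorEnd (T : ∀ (V : Type u) [AddCommGroup V] [Module R V],
    (⨂[R] _ : Fin n, V) →ₗ[R] (⨂[R] _ : Fin n, V)) : Prop :=
  ∀ (V V' : Type u) [AddCommGroup V] [Module R V] [AddCommGroup V'] [Module R V'] (f : V →ₗ[R] V'),
    (PiTensorProduct.map fun _ : Fin n => f) ∘ₗ T V = T V' ∘ₗ PiTensorProduct.map fun _ : Fin n => f

/-- The basis of `(Rⁿ)^{⊗n}` formed by the words of length `n` in the standard basis of `Rⁿ`. -/
def wordBasis (R : Type u) [CommRing R] (n : ℕ) :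
    Module.Basis (Fin n → Fin n) R (⨂[R] _ : Fin n, (Fin n → R)) :=
  Basis.piTensorProduct fun _ => Pi.basisFun R (Fin n)

/-- The endomorphism of `Rⁿ` that kills the `j`-th basis vector and fixes the others. -/
def killCoord (R : Type u) [CommRing R] (j : Fin n) : (Fin n → R) →ₗ[R] (Fin n → R) :=
  LinearMap.pi (Function.update LinearMap.proj j 0)

theorem killCoord_single (j : Fin n) : killCoord R j (Pi.single j 1) = 0 := by
  ext i
  obtain rfl | hij := eq_or_ne i j <;> simp [killCoord, *]

theorem wordBasis_repr_map_killCoord {j : Fin n} {w : Fin n → Fin n} (hw : ∀ i, w i ≠ j)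
    (t : ⨂[R] _ : Fin n, (Fin n → R)) :
    (wordBasis R n).repr (PiTensorProduct.map (fun _ => killCoord R j) t) w =
      (wordBasis R n).repr t w := by
  induction t using PiTensorProduct.induction_on with
  | smul_tprod r v => simp [wordBasis, killCoord, hw]
  | add x y hx hy => simp only [map_add, Finsupp.add_apply, hx, hy]

section

variable {T : ∀ (V : Type u) [AddCommGroup V] [Module R V],
  (⨂[R] _ : Fin n, V) →ₗ[R] (⨂[R] _ : Fin n, V)}

theorem IsNaturalTensorEnd.map_apply_tprod (hT : IsNaturalTensorEnd T) {V V' : Type u}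
    [AddCommGroup V] [Module R V] [AddCommGroup V'] [Module R V'] (f : V →ₗ[R] V')
    (v : Fin n → V) :
    PiTensorProduct.map (fun _ => f) (T V (PiTensorProduct.tprod R v)) =
      T V' (PiTensorProduct.tprod R fun i => f (v i)) :=
  (LinearMap.congr_fun (hT V V' f) _).trans (congrArg (T V') (PiTensorProduct.map_tprod _ _))

theorem IsNaturalTensorEnd.wordBasis_repr_eq_zero (hT : IsNaturalTensorEnd T)
    {w : Fin n → Fin n} (hw : ¬ Function.Surjective w) :
    (wordBasis R n).repr (T _ (PiTensorProduct.tprod R fun i => Pi.single i (1 : R))) w = 0 := by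
  obtain ⟨j, hj⟩ := not_forall.1 hw
  rw [← wordBasis_repr_map_killCoord fun i hi => hj ⟨i, hi⟩, hT.map_apply_tprod,
    MultilinearMap.map_coord_zero _ j (killCoord_single j), map_zero, map_zero, Finsupp.zero_apply]

theorem IsNaturalTensorEnd.apply_tprod_single (hT : IsNaturalTensorEnd T) :
    ∃ e : MonoidAlgebra R (Equiv.Perm (Fin n)),
      T (Fin n → R) (PiTensorProduct.tprod R fun i => Pi.single i 1) =
        ∑ τ, e.coeff τ • PiTensorProduct.tprod R fun i => Pi.single (τ.symm i) 1 := by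
  set t := T (Fin n → R) (PiTensorProduct.tprod R fun i => Pi.single i 1)
  refine ⟨MonoidAlgebra.ofCoeff (Finsupp.equivFunOnFinite.symm fun τ =>
    (wordBasis R n).repr t τ.symm), ?_⟩
  refine ((wordBasis R n).sum_repr t).symm.trans (Eq.symm ?_)
  refine Finset.sum_of_injOn (fun τ : Equiv.Perm (Fin n) => (τ.symm : Fin n → Fin n))
    ((DFunLike.coe_injective.comp Equiv.symm_bijective.injective).injOn) (by simp) ?_ ?_
  · intro w _ hw
    rw [hT.wordBasis_repr_eq_zero, zero_smul]
    intro hs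
    exact hw ⟨(Equiv.ofBijective w (Finite.surjective_iff_bijective.1 hs)).symm, by simp, rfl⟩
  · intro τ _
    simp [wordBasis]

/-- A natural endomorphism is determined by its value on `e₁ ⊗ ⋯ ⊗ eₙ`, since every
`v₁ ⊗ ⋯ ⊗ vₙ` is the image of this tensor under a linear map `Rⁿ → V`. -/
theorem IsNaturalTensorEnd.exists_eq_sum_reindex (hT : IsNaturalTensorEnd T) :
    ∃ e : MonoidAlgebra R (Equiv.Perm (Fin n)), ∀ (V : Type u) [AddCommGroup V] [Module R V],
      T V = ∑ τ, e.coeff τ • (PiTensorProduct.reindex R (fun _ : Fin n => V) τ).toLinearMap := by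
  obtain ⟨e, he⟩ := hT.apply_tprod_single
  refine ⟨e, fun V _ _ => PiTensorProduct.ext (MultilinearMap.ext fun v => ?_)⟩
  let f : (Fin n → R) →ₗ[R] V := Fintype.linearCombination R v
  have hf : ∀ i, f (Pi.single i 1) = v i := fun i => by
    rw [Fintype.linearCombination_apply_single, one_smul]
  have hTv := hT.map_apply_tprod f fun i => Pi.single i 1
  simp only [he, map_sum, map_smul, PiTensorProduct.map_tprod, hf] at hTv
  simp only [LinearMap.compMultilinearMap_apply, ← hTv, LinearMap.sum_apply, LinearMap.smul_apply]
  refine Finset.sum_congr rfl fun τ _ => congrArg _ ?_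
  exact (PiTensorProduct.reindex_tprod (R := R) (s := fun _ => V) τ v).symm

end

theorem FunctorialRetract.exists_isInducedBy (M : FunctorialRetract R n) :
    ∃ e, M.IsInducedBy e :=
  IsNaturalTensorEnd.exists_eq_sum_reindex M.natural

/-- Apply the retraction to the bottom cell `1 ⊗ ⋯ ⊗ 1` of `R^{⊗n} ≅ R`. -/
theorem FunctorialRetract.sum_coeff_eq_one {M : FunctorialRetract R n} (hM : M.ContainsBottomCell)
    {e : MonoidAlgebra R (Equiv.Perm (Fin n))} (he : M.IsInducedBy e) :
    ∑ τ, e.coeff τ = 1 := by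
  have hreindex : ∀ τ : Equiv.Perm (Fin n),
      (PiTensorProduct.reindex R (fun _ : Fin n => R) τ).toLinearMap
        (PiTensorProduct.tprod R fun _ => 1) = PiTensorProduct.tprod R fun _ => 1 :=
    fun τ => PiTensorProduct.reindex_tprod (R := R) (s := fun _ => R) τ fun _ => 1
  have h := hM R 1
  simp only [he R, LinearMap.sum_apply, LinearMap.smul_apply, hreindex] at h
  simpa [PiTensorProduct.lift.tprod] using
    congrArg (PiTensorProduct.lift (MultilinearMap.mkPiAlgebra R (Fin n) R)) h

end NaturalEndomorphisms

/-! ### Precomposition and postcomposition of homotopy classes -/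

section Composition

variable {X : Type u} {Y : Type v} {W : Type w} [TopologicalSpace X] [Based X]
  [TopologicalSpace Y] [Based Y] [TopologicalSpace W] [Based W]

theorem PMap.comp_apply (g : PMap Y W) (f : PMap X Y) (x : X) :
    (g.comp f).toMap x = g.toMap (f.toMap x) := rfl

theorem PMap.const_apply (x : X) : (PMap.const X Y).toMap x = Based.pt := rfl

/-- The map `[Y, W] → [X, W]` induced by a map `X → Y`. -/
def HClass.precomp (h : PMap X Y) : HClass Y W → HClass X W :=
  Quotient.map (PMap.comp · h) fun _ _ e => PMap.comp_homotopic e (.refl h.toMap)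

theorem HClass.precomp_precomp_of_homotopic_id {h : PMap X Y} {g : PMap Y X}
    (e : (g.comp h).Homotopic (PMap.id X)) (c : HClass X W) :
    HClass.precomp h (HClass.precomp g c) = c :=
  Quotient.inductionOn c fun f => Quotient.sound (PMap.comp_homotopic (.refl f.toMap) e)

theorem HClass.precomp_bijective {h : PMap X Y} {g : PMap Y X}
    (hl : (g.comp h).Homotopic (PMap.id X)) (hr : (h.comp g).Homotopic (PMap.id Y)) :
    Function.Bijective (HClass.precomp h : HClass Y W → HClass X W) :=
  Function.bijective_iff_has_inverse.2 ⟨HClass.precomp g,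
    HClass.precomp_precomp_of_homotopic_id hr, HClass.precomp_precomp_of_homotopic_id hl⟩

end Composition

section Additivity

variable {n : ℕ} {A : Type u} [TopologicalSpace A] [Based A] [T1Space A] {W : Type v}
  [TopologicalSpace W] [Based W] {W' : Type w} [TopologicalSpace W'] [Based W']

theorem PMap.comp_addAt (i : Fin n) (f : PMap W W') (g h : PMap (Smash n (Susp A)) W) :
    f.comp (PMap.addAt i g h) = PMap.addAt i (f.comp g) (f.comp h) :=
  PMap.ext_coord i fun x a t hx => by
    rw [PMap.comp_apply, PMap.addAt_mk i _ _ x a t hx, PMap.addAt_mk i _ _ x a t hx]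
    split_ifs <;> rfl

/-- The homomorphism `[(ΣA)^{(n)}, W] → [(ΣA)^{(n)}, W']` induced by a map `W → W'`. -/
def HClass.postcomp [NeZero n] (f : PMap W W') :
    HClass (Smash n (Susp A)) W →+ HClass (Smash n (Susp A)) W' :=
  AddMonoidHom.mk' (Quotient.map f.comp fun _ _ h => PMap.comp_homotopic (.refl f.toMap) h)
    fun a b => Quotient.inductionOn₂ a b fun g h => congrArg PMap.cls (PMap.comp_addAt 0 f g h)

theorem HClass.postcomp_cls [NeZero n] (f : PMap W W') (g : PMap (Smash n (Susp A)) W) :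
    HClass.postcomp f g.cls = (f.comp g).cls := rfl

theorem HClass.isUnital_addAt (i : Fin n) :
    EckmannHilton.IsUnital (HClass.addAt (A := A) (W := W) i) (PMap.cls (PMap.const _ _)) where
  left_id a := Quotient.inductionOn a fun f => Quotient.sound (PMap.zero_addAt i f)
  right_id a := Quotient.inductionOn a fun f => Quotient.sound (PMap.addAt_zero i f)

theorem HClass.addAt_interchange {i j : Fin n} (hij : i ≠ j)
    (a b c d : HClass (Smash n (Susp A)) W) :
    HClass.addAt i (HClass.addAt j a b) (HClass.addAt j c d) =
      HClass.addAt j (HClass.addAt i a c) (HClass.addAt i b d) :=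
  Quotient.inductionOn₂ a b fun f g => Quotient.inductionOn₂ c d fun h k =>
    congrArg PMap.cls (PMap.addAt_interchange hij f g h k)

theorem HClass.addAt_eq_add [NeZero n] (i : Fin n) (a b : HClass (Smash n (Susp A)) W) :
    HClass.addAt i a b = a + b := by
  obtain rfl | hi := eq_or_ne i 0
  · rfl
  · exact congrFun₂ (EckmannHilton.mul (HClass.isUnital_addAt i) (HClass.isUnital_addAt 0)
      (HClass.addAt_interchange hi)) a b

theorem permMap_mk {X : Type u} [TopologicalSpace X] [Based X] (τ : Equiv.Perm (Fin n))
    (x : Fin n → X) : (permMap τ).toMap (Smash.mk x) = Smash.mk (x ∘ τ.symm) := rfl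

theorem permMap_comp {X : Type u} [TopologicalSpace X] [Based X] (ρ τ : Equiv.Perm (Fin n)) :
    (permMap ρ).comp (permMap τ) = (permMap (ρ * τ) : PMap (Smash n X) (Smash n X)) :=
  PMap.ext_apply (Smash.ind fun _ => rfl)

theorem PMap.addAt_comp_permMap (τ : Equiv.Perm (Fin n)) (i : Fin n)
    (f g : PMap (Smash n (Susp A)) W) : (PMap.addAt i f g).comp (permMap τ) =
      PMap.addAt (τ.symm i) (f.comp (permMap τ)) (g.comp (permMap τ)) := by
  refine PMap.ext_coord (τ.symm i) fun x a t hx => ?_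
  have hupdate (z : Susp A) : Function.update x (τ.symm i) z ∘ τ.symm =
      Function.update (x ∘ τ.symm) i z := by
    rw [Function.update_comp_equiv, Equiv.symm_symm, Equiv.apply_symm_apply]
  rw [PMap.comp_apply, permMap_mk, PMap.addAt_mk i _ _ (x ∘ τ.symm) a t hx,
    PMap.addAt_mk (τ.symm i) _ _ x a t hx, PMap.comp_apply, PMap.comp_apply, permMap_mk,
    permMap_mk, hupdate, hupdate]

/-- The endomorphism of `[(ΣA)^{(n)}, W]` induced by a permutation of the smash factors. -/
def HClass.precompPerm [NeZero n] (τ : Equiv.Perm (Fin n)) :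
    HClass (Smash n (Susp A)) W →+ HClass (Smash n (Susp A)) W :=
  AddMonoidHom.mk' (HClass.precomp (permMap τ)) fun a b => by
    refine Eq.trans ?_ (HClass.addAt_eq_add (τ.symm 0) _ _)
    exact Quotient.inductionOn₂ a b fun g h => congrArg PMap.cls (PMap.addAt_comp_permMap τ 0 g h)

theorem HClass.precompPerm_cls [NeZero n] (τ : Equiv.Perm (Fin n))
    (f : PMap (Smash n (Susp A)) W) :
    HClass.precompPerm τ f.cls = (f.comp (permMap τ)).cls := rfl

end Additivity

/-! ### Sums over all permutations -/

section PermSum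

variable {n : ℕ} {G : Type v} [AddGroup G] {H : Type w} [AddGroup H]

theorem map_permSum (f : G →+ H) (c : Equiv.Perm (Fin n) → G) :
    f (permSum c) = permSum fun τ => f (c τ) := by
  rw [permSum, permSum, map_list_sum, List.map_map]
  rfl

theorem permSum_eq_sum {G : Type v} [AddCommGroup G] (c : Equiv.Perm (Fin n) → G) :
    permSum c = ∑ τ, c τ := Finset.sum_map_toList _ _

theorem permSum_zsmul_const (k : Equiv.Perm (Fin n) → ℤ) (g : G) :
    (permSum fun τ => k τ • g) = (∑ τ, k τ) • g := by
  rw [← permSum_eq_sum]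
  exact (map_permSum (zmultiplesHom G g) k).symm

theorem permSum_of_lt_two (hn : n < 2) (c : Equiv.Perm (Fin n) → G) : permSum c = c 1 := by
  interval_cases n <;> simp [permSum]

theorem permSum_mul_right (hG : 2 ≤ n → ∀ a b : G, a + b = b + a) (c : Equiv.Perm (Fin n) → G)
    (ρ : Equiv.Perm (Fin n)) : (permSum fun τ => c (τ * ρ)) = permSum c := by
  obtain hn | hn := lt_or_ge n 2
  · rw [permSum_of_lt_two hn, permSum_of_lt_two hn]
    interval_cases n <;> exact congrArg c (Subsingleton.elim _ _)
  · let _ : AddCommGroup G := { (inferInstance : AddGroup G) with add_comm := hG hn }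
    exact (permSum_eq_sum _).trans
      ((Equiv.sum_comp (Equiv.mulRight ρ) c).trans (permSum_eq_sum c).symm)

theorem nsmul_permSum (hG : 2 ≤ n → ∀ a b : G, a + b = b + a) (c : Equiv.Perm (Fin n) → G)
    (N : ℕ) : N • permSum c = permSum fun τ => N • c τ := by
  obtain hn | hn := lt_or_ge n 2
  · rw [permSum_of_lt_two hn, permSum_of_lt_two hn]
  · let _ : AddCommGroup G := { (inferInstance : AddGroup G) with add_comm := hG hn }
    exact map_permSum (nsmulAddMonoidHom N) c

end PermSum

/-! ### Homotopy classes represented by elements of the group ring -/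

section Coefficients

variable {p : ℕ} [Fact p.Prime]

theorem ZLoc.intCast_injective : Function.Injective (Int.cast : ℤ → ZLoc p) := fun _ _ h =>
  IsLocalization.injective (ZLoc p)
    (Ideal.primeCompl_le_nonZeroDivisors (Ideal.span {(p : ℤ)})) (by simpa using h)

theorem ZLoc.exists_common_denominator {ι : Type*} [Finite ι] (e : ι → ZLoc p) :
    ∃ (N : ℕ) (k : ι → ℤ), ¬ p ∣ N ∧ ∀ i, (N : ZLoc p) * e i = (k i : ZLoc p) := by
  obtain ⟨⟨b, hb⟩, hbe⟩ := IsLocalization.exist_integer_multiples_of_finite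
    (Ideal.span {(p : ℤ)}).primeCompl e
  choose k hk using hbe
  rw [Ideal.mem_primeCompl_iff, Ideal.mem_span_singleton] at hb
  have hk' (i : ι) : (b : ZLoc p) * e i = (k i : ZLoc p) := by
    simpa [Algebra.smul_def] using (hk i).symm
  refine ⟨b.natAbs, fun i => b.sign * k i, fun h => hb (Int.natCast_dvd.2 h), fun i => ?_⟩
  have habs : ((b.natAbs : ℕ) : ZLoc p) = b.sign * b := by
    rw [← Int.cast_mul, Int.sign_mul_self_eq_natAbs, Int.cast_natCast]
  rw [habs, mul_assoc, hk', Int.cast_mul]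

end Coefficients

section Classes

variable {p : ℕ} [Fact p.Prime] {n : ℕ} [NeZero n] {A : Type u} [TopologicalSpace A] [Based A]
  [T1Space A] {W : Type v} [TopologicalSpace W] [Based W]

theorem existsUnique_represents
    (hdiv : ∀ N : ℕ, ¬ p ∣ N → Function.Bijective
      fun c : HClass (Smash n (Susp A)) (Smash n (Susp A)) => N • c)
    (e : MonoidAlgebra (ZLoc p) (Equiv.Perm (Fin n))) :
    ∃! c : HClass (Smash n (Susp A)) (Smash n (Susp A)), Represents p e c := by
  obtain ⟨N, k, hN, hk⟩ := ZLoc.exists_common_denominator e.coeff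
  obtain ⟨c, hc : N • c = _⟩ := (hdiv N hN).2 (permSum fun τ => k τ • (permMap τ).cls)
  refine ⟨c, ⟨N, k, hN, hk, hc⟩, ?_⟩
  rintro c' ⟨N', k', hN', hk', hc'⟩
  have hNk (τ) : (N : ℤ) * k' τ = N' * k τ := by
    refine ZLoc.intCast_injective (p := p) ?_
    push_cast
    rw [← hk, ← hk', mul_left_comm]
  have hsmul (M : ℕ) (l : Equiv.Perm (Fin n) → ℤ) :
      M • (permSum fun τ => l τ • (permMap τ : PMap (Smash n (Susp A)) _).cls) =
        permSum fun τ => ((M : ℤ) * l τ) • (permMap τ).cls := by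
    simp only [nsmul_permSum HClass.add_comm_of_two_le, mul_zsmul, natCast_zsmul]
  refine (hdiv (N' * N) fun h => ((Fact.out : p.Prime).dvd_mul.1 h).elim hN' hN).1 ?_
  calc (N' * N) • c'
    _ = permSum fun τ => ((N : ℤ) * k' τ) • (permMap τ).cls := by rw [mul_nsmul, hc', hsmul]
    _ = permSum fun τ => ((N' : ℤ) * k τ) • (permMap τ).cls := by simp only [hNk]
    _ = (N' * N) • c := by rw [mul_nsmul', hc, hsmul]

theorem HClass.precompPerm_traceClass (τ : Equiv.Perm (Fin n)) :
    HClass.precompPerm τ (traceClass n A) = traceClass n A := by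
  simp only [traceClass, map_permSum, HClass.precompPerm_cls, permMap_comp]
  exact permSum_mul_right HClass.add_comm_of_two_le (fun ρ => (permMap ρ).cls) τ

/-- A symmetric map absorbs the elements of augmentation one. -/
theorem cls_comp_eq_of_represents
    (hdiv : ∀ N : ℕ, ¬ p ∣ N → Function.Injective fun c : HClass (Smash n (Susp A)) W => N • c)
    {e : MonoidAlgebra (ZLoc p) (Equiv.Perm (Fin n))} (he : ∑ τ, e.coeff τ = 1)
    {a : PMap (Smash n (Susp A)) (Smash n (Susp A))} (ha : Represents p e a.cls)
    {φ : PMap (Smash n (Susp A)) W} (hφ : ∀ τ, HClass.precompPerm τ φ.cls = φ.cls) :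
    (φ.comp a).cls = φ.cls := by
  obtain ⟨N, k, hN, hk, hc⟩ := ha
  have hsum : ∑ τ, k τ = N := by
    refine ZLoc.intCast_injective (p := p) ?_
    push_cast
    rw [← Finset.sum_congr rfl fun τ _ => hk τ, ← Finset.mul_sum, he, mul_one]
  refine hdiv N hN ?_
  calc N • (φ.comp a).cls
    _ = HClass.postcomp φ (permSum fun τ => k τ • (permMap τ).cls) := by
      rw [← hc, map_nsmul, HClass.postcomp_cls]
    _ = permSum fun τ => k τ • φ.cls := by
      rw [map_permSum]
      simp only [map_zsmul, HClass.postcomp_cls, ← HClass.precompPerm_cls, hφ]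
    _ = N • φ.cls := by rw [permSum_zsmul_const, hsum, natCast_zsmul]

end Classes

theorem Hocolim.exists_comp_incl_eq {Y : Type u} [TopologicalSpace Y] [Based Y] {Z : Type v}
    [TopologicalSpace Z] [Based Z] (a : PMap Y Y) (φ : PMap Y Z)
    (h : φ.Homotopic (φ.comp a)) : ∃ b : PMap (Hocolim a) Z, b.comp (Hocolim.incl a) = φ := by
  obtain ⟨H, cH, H0, H1, Hp⟩ := h.family
  refine ⟨⟨⟨Quot.lift (fun q : ℕ × I × Y => H q.2.1 q.2.2) ?_, continuous_quot_lift _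
    (cH.comp (by fun_prop : Continuous fun q : ℕ × I × Y => (q.2.1, q.2.2)))⟩, Hp 0⟩,
    PMap.ext_apply H0⟩
  rintro _ _ (⟨k, y⟩ | ⟨k, t⟩)
  · exact (H1 y).trans (H0 _).symm
  · exact (Hp t).trans (Hp 0).symm

/-! ### Multiples of a homotopy class -/

/-- The `k`-fold wrapping `I/∂I → I/∂I`, in the parametrization used for iterated sums. -/
def wrap : ℕ → I → I
  | 0, _ => 0
  | k + 1, t => if (t : ℝ) ≤ 1 / 2 then low t else wrap k (high t)

theorem low_zero : low 0 = 0 := Subtype.ext (by simp [coe_low])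

theorem high_one : high 1 = 1 := Subtype.ext (by norm_num [coe_high])

theorem wrap_zero (k : ℕ) : wrap k 0 = 0 := by
  cases k with
  | zero => rfl
  | succ k => rw [wrap, if_pos (by norm_num), low_zero]

theorem wrap_one (k : ℕ) : wrap k 1 = 0 := by
  induction k with
  | zero => rfl
  | succ k ih => rw [wrap, if_neg (by norm_num), high_one, ih]

theorem continuous_comp_wrap {T : Type u} {Y : Type v} [TopologicalSpace T] [TopologicalSpace Y]
    {F : T × I → Y} (hF : Continuous F) (h : ∀ x, F (x, 0) = F (x, 1)) (k : ℕ) :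
    Continuous fun q : T × I => F (q.1, wrap k q.2) := by
  induction k with
  | zero => exact hF.comp (by fun_prop : Continuous fun q : T × I => (q.1, (0 : I)))
  | succ k ih =>
    have cl := continuous_low
    have ch := continuous_high
    have hif : Continuous fun q : T × I =>
        if (q.2 : ℝ) ≤ 1 / 2 then F (q.1, low q.2) else F (q.1, wrap k (high q.2)) :=
      Continuous.if_le (hF.comp (by fun_prop))
        (ih.comp (by fun_prop : Continuous fun q : T × I => (q.1, high q.2)))
        (by fun_prop) (by fun_prop) fun q hq => by
          rw [low_eq_one hq.ge, high_eq_zero hq.le, wrap_zero, h]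
    refine hif.congr fun q => ?_
    rw [wrap]
    split_ifs <;> rfl

section SuspMaps

variable {A : Type u} [TopologicalSpace A] [Based A] {Y : Type v} [TopologicalSpace Y] [Based Y]

/-- The map out of the suspension given by a map on `A × [0,1]`. -/
def PMap.ofSusp (F : A → I → Y) (hc : Continuous fun q : A × I => F q.1 q.2)
    (h : ∀ a t, (a = Based.pt ∨ t = 0 ∨ t = 1) → F a t = Based.pt) : PMap (Susp A) Y where
  toMap := ⟨Quotient.lift (fun q : A × I => F q.1 q.2) (by
      rintro x y (rfl | ⟨hx, hy⟩)
      · rfl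
      · rw [h _ _ hx, h _ _ hy]), hc.quotient_lift _⟩
  map_pt := h _ _ (.inl rfl)

/-- The self map of degree `k` of a suspension. -/
def suspWrap (A : Type u) [TopologicalSpace A] [Based A] (k : ℕ) : PMap (Susp A) (Susp A) :=
  PMap.ofSusp (fun a t => Susp.mk a (wrap k t))
    (continuous_comp_wrap (F := fun q : A × I => Susp.mk q.1 q.2) Susp.continuous_mk
      (fun _ => Susp.mk_eq_iff.2 (.inr ⟨.inr (.inl rfl), .inr (.inr rfl)⟩)) k)
    (by
      rintro a t (h | rfl | rfl)
      · exact Susp.mk_eq_pt.2 (.inl h)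
      · exact Susp.mk_eq_pt.2 (.inr (.inl (wrap_zero k)))
      · exact Susp.mk_eq_pt.2 (.inr (.inl (wrap_one k))))

theorem suspWrap_mk (k : ℕ) (a : A) (t : I) :
    (suspWrap A k).toMap (Susp.mk a t) = Susp.mk a (wrap k t) := rfl

end SuspMaps

section OnCoord

variable {n : ℕ} {X : Type u} [TopologicalSpace X] [Based X]

/-- The self map of the smash power that applies a pointed map to the `i`-th smash factor. -/
def PMap.onCoord (i : Fin n) (g : PMap X X) : PMap (Smash n X) (Smash n X) where
  toMap := ⟨Smash.onCoord i g.toMap g.map_pt,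
    (Smash.continuous_onCoord (P := Unit) i (fun _ => g.toMap) (fun _ => g.map_pt)
      (by fun_prop)).comp (by fun_prop : Continuous fun z : Smash n X => ((), z))⟩
  map_pt := Smash.onCoord_pt i g.toMap g.map_pt

theorem PMap.onCoord_mk (i : Fin n) (g : PMap X X) (x : Fin n → X) :
    (PMap.onCoord i g).toMap (Smash.mk x) = Smash.mk (Function.update x i (g.toMap (x i))) := rfl

theorem PMap.onCoord_id (i : Fin n) : PMap.onCoord i (PMap.id X) = PMap.id (Smash n X) :=
  PMap.ext_apply (Smash.ind fun x => congrArg Smash.mk (Function.update_eq_self i x))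

theorem PMap.onCoord_comp (i : Fin n) (g h : PMap X X) :
    PMap.onCoord i (g.comp h) = (PMap.onCoord i g).comp (PMap.onCoord i h) :=
  PMap.ext_apply (Smash.ind fun x => by
    rw [PMap.comp_apply, PMap.onCoord_mk, PMap.onCoord_mk, PMap.onCoord_mk, Function.update_idem,
      Function.update_self, PMap.comp_apply])

theorem PMap.onCoord_homotopic (i : Fin n) {g h : PMap X X} (e : g.Homotopic h) :
    (PMap.onCoord i g).Homotopic (PMap.onCoord i h) := by
  obtain ⟨F, cF, F0, F1, Fp⟩ := e.family
  refine PMap.homotopic_of_family _ _ (fun s => Smash.onCoord i (F s) (Fp s))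
    (Smash.continuous_onCoord i F Fp cF) (Smash.ind fun x => ?_) (Smash.ind fun x => ?_)
    fun s => Smash.onCoord_pt i _ _
  · rw [Smash.onCoord_mk, F0, PMap.onCoord_mk]
  · rw [Smash.onCoord_mk, F1, PMap.onCoord_mk]

theorem PMap.onCoord_homotopic_id (i : Fin n) {g h : PMap X X}
    (e : (g.comp h).Homotopic (PMap.id X)) :
    ((PMap.onCoord i g).comp (PMap.onCoord i h)).Homotopic (PMap.id (Smash n X)) := by
  rw [← PMap.onCoord_comp, ← PMap.onCoord_id i]
  exact PMap.onCoord_homotopic i e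

end OnCoord

section Multiples

variable {n : ℕ} {A : Type u} [TopologicalSpace A] [Based A] {W : Type v}
  [TopologicalSpace W] [Based W]

theorem PMap.comp_onCoord_suspWrap_zero (i : Fin n) (f : PMap (Smash n (Susp A)) W) :
    f.comp (PMap.onCoord i (suspWrap A 0)) = PMap.const _ _ :=
  PMap.ext_coord i fun x a t hx => by
    rw [PMap.comp_apply, PMap.onCoord_mk, hx, suspWrap_mk, wrap,
      mk_update_pt i x (Susp.mk_eq_pt.2 (.inr (.inl rfl))), f.map_pt, PMap.const_apply]

variable [T1Space A]

theorem PMap.comp_onCoord_suspWrap_succ (i : Fin n) (f : PMap (Smash n (Susp A)) W) (k : ℕ) :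
    f.comp (PMap.onCoord i (suspWrap A (k + 1))) =
      PMap.addAt i f (f.comp (PMap.onCoord i (suspWrap A k))) :=
  PMap.ext_coord i fun x a t hx => by
    rw [PMap.comp_apply, PMap.addAt_mk i _ _ x a t hx, PMap.onCoord_mk, hx, suspWrap_mk, wrap]
    split_ifs
    · rfl
    · rw [PMap.comp_apply, PMap.onCoord_mk, Function.update_self, suspWrap_mk,
        Function.update_idem]

theorem HClass.nsmul_eq_precomp [NeZero n] (k : ℕ) (c : HClass (Smash n (Susp A)) W) :
    k • c = HClass.precomp (PMap.onCoord 0 (suspWrap A k)) c := by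
  refine Quotient.inductionOn c fun f => ?_
  change k • f.cls = (f.comp (PMap.onCoord 0 (suspWrap A k))).cls
  induction k with
  | zero => rw [zero_nsmul, PMap.comp_onCoord_suspWrap_zero]; rfl
  | succ k ih => rw [succ_nsmul', ih, HClass.cls_add, PMap.comp_onCoord_suspWrap_succ]

theorem HClass.nsmul_bijective [NeZero n] {N : ℕ} {g : PMap (Susp A) (Susp A)}
    (hl : (g.comp (suspWrap A N)).Homotopic (PMap.id _))
    (hr : ((suspWrap A N).comp g).Homotopic (PMap.id _)) :
    Function.Bijective fun c : HClass (Smash n (Susp A)) W => N • c := by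
  simp only [HClass.nsmul_eq_precomp]
  exact HClass.precomp_bijective (PMap.onCoord_homotopic_id 0 hl) (PMap.onCoord_homotopic_id 0 hr)

end Multiples

/-! ### Box pairs -/

section Box

variable {T : Type u}

/-- The part `T × {0} ∪ S × I` of the prism `T × I`. -/
def prismBox (S : Set T) : Set (T × I) := {z | z.2 = 0 ∨ z.1 ∈ S}

/-- The part `T × {0, 1} ∪ S × I` of the prism `T × I`. -/
def prismBoundary (S : Set T) : Set (T × I) := {z | z.1 ∈ S ∨ z.2 = 0 ∨ z.2 = 1}

theorem prismBox_subset_prismBoundary (S : Set T) : prismBox S ⊆ prismBoundary S := by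
  rintro z (hz | hz)
  exacts [.inr (.inl hz), .inl hz]

variable [TopologicalSpace T] {T' : Type v} [TopologicalSpace T'] {F : Type w} [TopologicalSpace F]

/-- A closed cofibration `S ⊆ T`, encoded as a strong deformation retraction of the prism `T × I`
onto `T × {0} ∪ S × I` along tracks whose length is measured by the function `φ`. -/
structure IsBoxPair (S : Set T) : Prop where
  isClosed : IsClosed S
  exists_deformation : ∃ (D : (T × I) × I → T × I) (φ : T × I → I), Continuous D ∧ Continuous φ ∧
    (∀ z, D (z, 0) ∈ prismBox S) ∧ (∀ z, D (z, φ z) = z) ∧ ∀ z ∈ prismBox S, φ z = 0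

theorem isClosed_prismBox {S : Set T} (hS : IsClosed S) : IsClosed (prismBox S) :=
  (isClosed_eq continuous_snd continuous_const).union (hS.preimage continuous_fst)

open Classical in
theorem continuousOn_prismBox {S : Set T} (hS : IsClosed S) {g : T → F} {Q : T × I → F}
    (hg : Continuous g) (hQ : ContinuousOn Q (Prod.fst ⁻¹' S)) (h : ∀ x ∈ S, Q (x, 0) = g x) :
    ContinuousOn (fun z : T × I => if z.1 ∈ S then Q z else g z.1) (prismBox S) := by
  change ContinuousOn _ ({z : T × I | z.2 = 0} ∪ Prod.fst ⁻¹' S)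
  refine ContinuousOn.union_of_isClosed ?_ (hQ.congr fun z hz => if_pos hz)
    (isClosed_eq continuous_snd continuous_const) (hS.preimage continuous_fst)
  refine (hg.comp continuous_fst).continuousOn.congr ?_
  rintro ⟨x, t⟩ rfl
  dsimp only
  split_ifs with hx
  exacts [h x hx, rfl]

/-- The condition on `G` and `Q` says that the homotopies agree along the rim `S × {1}`. -/
theorem continuousOn_prismBoundary {S : Set T} (hS : IsClosed S) {Q : T × I → F}
    {G : (T × I) × I → F} (hQ : Continuous Q) (hG : Continuous G)
    (h : ∀ x ∈ S, ∀ t, G ((x, 1), t) = Q (x, t)) :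
    ContinuousOn (fun q : (T × I) × I => if q.1.2 = 1 then Q (q.1.1, q.2) else G q)
      (Prod.fst ⁻¹' prismBoundary S) := by
  have hunion : Prod.fst ⁻¹' prismBoundary S =
      {q : (T × I) × I | q.1.2 = 1} ∪ Prod.fst ⁻¹' prismBox S := by
    ext q
    simp only [prismBoundary, prismBox, Set.mem_preimage, Set.mem_ofPred_eq, Set.mem_union]
    tauto
  rw [hunion]
  refine ContinuousOn.union_of_isClosed ?_ ?_ (isClosed_eq (by fun_prop) (by fun_prop))
    ((isClosed_prismBox hS).preimage continuous_fst)
  · refine ContinuousOn.congr (f := fun q => Q (q.1.1, q.2)) (by fun_prop) fun q hq => ?_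
    exact if_pos hq
  · refine hG.continuousOn.congr ?_
    rintro ⟨⟨x, s⟩, t⟩ hq
    dsimp only
    split_ifs with hs
    · subst hs
      exact (h x (hq.resolve_left one_ne_zero) t).symm
    · rfl

namespace IsBoxPair

variable {S : Set T}

theorem preimage (hS : IsBoxPair S) (h : T' ≃ₜ T) : IsBoxPair (h ⁻¹' S) := by
  obtain ⟨D, φ, cD, cφ, h0, h1, h2⟩ := hS.exists_deformation
  refine ⟨hS.isClosed.preimage h.continuous,
    fun q => (h.symm (D ((h q.1.1, q.1.2), q.2)).1, (D ((h q.1.1, q.1.2), q.2)).2),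
    fun z => φ (h z.1, z.2), by fun_prop, by fun_prop, fun z => ?_, fun z => ?_,
    fun z hz => h2 _ hz⟩
  · simpa [prismBox] using h0 (h z.1, z.2)
  · simp [h1]

theorem extend (hS : IsBoxPair S) {e : T × I → F} (he : ContinuousOn e (prismBox S)) :
    ∃ L : T × I → F, Continuous L ∧ ∀ z ∈ prismBox S, L z = e z := by
  obtain ⟨D, φ, cD, cφ, h0, h1, h2⟩ := hS.exists_deformation
  refine ⟨fun z => e (D (z, 0)), he.comp_continuous (by fun_prop) h0, fun z hz => congrArg e ?_⟩
  rw [← h2 z hz, h1]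

theorem extend_homotopy (hS : IsBoxPair S) {g : T → F} {Q : T × I → F}
    (hg : Continuous g) (hQ : ContinuousOn Q (Prod.fst ⁻¹' S)) (h : ∀ x ∈ S, Q (x, 0) = g x) :
    ∃ L : T × I → F, Continuous L ∧ (∀ x, L (x, 0) = g x) ∧ ∀ x ∈ S, ∀ t, L (x, t) = Q (x, t) := by
  classical
  obtain ⟨L, cL, hL⟩ := hS.extend (continuousOn_prismBox hS.isClosed hg hQ h)
  refine ⟨L, cL, fun x => ?_, fun x hx t => ?_⟩
  · rw [hL (x, 0) (.inl rfl)]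
    dsimp only
    split_ifs with hx
    exacts [h x hx, rfl]
  · rw [hL (x, t) (.inr hx)]
    exact if_pos hx

end IsBoxPair

end Box

/-! ### Cubes are box pairs -/

section Cube

variable {n : ℕ}

/-- The linear identification of the unit cube with the cube `[-1,1]^n`, which is the unit ball of
the supremum norm. -/
def centred (x : Fin n → I) : Fin n → ℝ := fun i => 2 * (x i : ℝ) - 1

theorem continuous_centred : Continuous (centred (n := n)) := by
  unfold centred; fun_prop

theorem norm_centred_le (x : Fin n → I) : ‖centred x‖ ≤ 1 := by
  refine (pi_norm_le_iff_of_nonneg zero_le_one).2 fun i => ?_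
  have h0 := (x i).2.1
  have h1 := (x i).2.2
  rw [Real.norm_eq_abs, centred, abs_le]
  constructor <;> linarith

theorem norm_centred_eq_one_iff {x : Fin n → I} :
    ‖centred x‖ = 1 ↔ x ∈ Cube.boundary (Fin n) := by
  constructor
  · intro h
    by_contra hx
    refine absurd h (ne_of_lt ((pi_norm_lt_iff zero_lt_one).2 fun i => ?_))
    have h0 : (0 : ℝ) < x i := unitInterval.pos_iff_ne_zero.2 fun h => hx ⟨i, .inl h⟩
    have h1 : (x i : ℝ) < 1 := unitInterval.lt_one_iff_ne_one.2 fun h => hx ⟨i, .inr h⟩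
    rw [Real.norm_eq_abs, centred, abs_lt]
    constructor <;> linarith
  · rintro ⟨i, hi⟩
    have habs : ‖centred x i‖ = 1 := by
      rcases hi with hi | hi <;> norm_num [centred, hi]
    exact le_antisymm (norm_centred_le x) (habs.ge.trans (norm_le_pi_norm (centred x) i))

theorem isClosed_cubeBoundary (n : ℕ) : IsClosed (Cube.boundary (Fin n)) := by
  have hsphere : Cube.boundary (Fin n) = {x | ‖centred x‖ = 1} :=
    Set.ext fun _ => norm_centred_eq_one_iff.symm
  rw [hsphere]
  exact isClosed_eq continuous_centred.norm continuous_const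

/-- The scaling factor that carries `z` along its ray from the point `(1/2, …, 1/2, 2)` above the
prism to the bottom and the sides, on which the value is `1`. -/
def boxGauge (z : (Fin n → I) × I) : ℝ := max ‖centred z.1‖ (1 - (z.2 : ℝ) / 2)

/-- Scaling by the factor `m⁻¹` from the point `(1/2, …, 1/2, 2)`, clipped to the prism. -/
def radial (m : ℝ) (z : (Fin n → I) × I) : (Fin n → I) × I :=
  (fun i => Set.projIcc 0 1 zero_le_one (1 / 2 + ((z.1 i : ℝ) - 1 / 2) / m),
    Set.projIcc 0 1 zero_le_one (2 - (2 - (z.2 : ℝ)) / m))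

theorem continuous_boxGauge : Continuous (boxGauge (n := n)) := by
  have := continuous_centred (n := n)
  unfold boxGauge
  fun_prop

theorem boxGauge_le_one (z : (Fin n → I) × I) : boxGauge z ≤ 1 :=
  max_le (norm_centred_le _) (by linarith [z.2.2.1])

theorem boxGauge_pos (z : (Fin n → I) × I) : 0 < boxGauge z :=
  lt_max_of_lt_right (by linarith [z.2.2.2])

theorem boxGauge_eq_one {z : (Fin n → I) × I} (hz : z ∈ prismBox (Cube.boundary (Fin n))) :
    boxGauge z = 1 := by
  refine le_antisymm (boxGauge_le_one z) ?_
  rcases hz with hz | hz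
  · exact le_max_of_le_right (by simp [hz])
  · exact le_max_of_le_left (norm_centred_eq_one_iff.2 hz).ge

theorem continuous_radial {X : Type*} [TopologicalSpace X] {m : X → ℝ} {f : X → (Fin n → I) × I}
    (hm : Continuous m) (hm0 : ∀ x, m x ≠ 0) (hf : Continuous f) :
    Continuous fun x => radial (m x) (f x) := by
  have hproj : Continuous (Set.projIcc (0 : ℝ) 1 zero_le_one) := continuous_projIcc
  refine Continuous.prodMk (continuous_pi fun i => hproj.comp ?_) (hproj.comp ?_)
  · exact continuous_const.add (Continuous.div (by fun_prop) hm hm0)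
  · exact continuous_const.sub (Continuous.div (by fun_prop) hm hm0)

theorem radial_one (z : (Fin n → I) × I) : radial 1 z = z := by
  simp [radial]

theorem centred_radial {z : (Fin n → I) × I} {m : ℝ} (hm : 0 < m) (h : ‖centred z.1‖ ≤ m) :
    centred (radial m z).1 = m⁻¹ • centred z.1 := by
  funext i
  have hi : |2 * (z.1 i : ℝ) - 1| ≤ m := (norm_le_pi_norm (centred z.1) i).trans h
  rw [abs_le] at hi
  have hlo : -1 ≤ (2 * (z.1 i : ℝ) - 1) / m := by rw [le_div_iff₀ hm]; linarith
  have hhi : (2 * (z.1 i : ℝ) - 1) / m ≤ 1 := by rw [div_le_one hm]; linarith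
  have heq : 1 / 2 + ((z.1 i : ℝ) - 1 / 2) / m = (1 + (2 * (z.1 i : ℝ) - 1) / m) / 2 := by
    field_simp
  simp only [centred, radial, Pi.smul_apply, smul_eq_mul]
  rw [heq, Set.projIcc_of_mem zero_le_one (x := (1 + (2 * (z.1 i : ℝ) - 1) / m) / 2)
    ⟨by linarith, by linarith⟩]
  field_simp
  ring

theorem radial_boxGauge_mem_prismBox (z : (Fin n → I) × I) :
    radial (boxGauge z) z ∈ prismBox (Cube.boundary (Fin n)) := by
  have hpos := boxGauge_pos z
  rcases le_total ‖centred z.1‖ (1 - (z.2 : ℝ) / 2) with h | h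
  · refine .inl ?_
    have hg : boxGauge z = 1 - (z.2 : ℝ) / 2 := max_eq_right h
    have hzero : (2 : ℝ) - (2 - (z.2 : ℝ)) / boxGauge z = 0 := by
      field_simp
      rw [hg]; ring
    simp [radial, hzero]
  · refine .inr (norm_centred_eq_one_iff.1 ?_)
    have hg : boxGauge z = ‖centred z.1‖ := max_eq_left h
    rw [centred_radial hpos hg.ge, norm_smul, norm_inv, Real.norm_of_nonneg hpos.le, ← hg,
      inv_mul_cancel₀ hpos.ne']

theorem isBoxPair_cube (n : ℕ) : IsBoxPair (Cube.boundary (Fin n)) := by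
  have hgauge := continuous_boxGauge (n := n)
  let φ : (Fin n → I) × I → I := fun z =>
    ⟨1 - boxGauge z, by linarith [boxGauge_le_one z], by linarith [boxGauge_pos z]⟩
  refine ⟨isClosed_cubeBoundary n, fun q => radial (min 1 (boxGauge q.1 + q.2)) q.1, φ,
    continuous_radial (by fun_prop) (fun q => ?_) continuous_fst, by fun_prop, fun z => ?_,
    fun z => ?_, fun z hz => Subtype.ext ?_⟩
  · exact (lt_min one_pos (add_pos_of_pos_of_nonneg (boxGauge_pos _) q.2.2.1)).ne'
  · simpa [boxGauge_le_one] using radial_boxGauge_mem_prismBox z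
  · simp [φ, radial_one]
  · simp [φ, boxGauge_eq_one hz]

/-- The first coordinate of a cube split off. -/
def cubeSplit (n : ℕ) : (Fin (n + 1) → I) ≃ₜ (Fin n → I) × I where
  toFun x := (Fin.tail x, x 0)
  invFun q := Fin.cons q.2 q.1
  left_inv x := Fin.cons_self_tail x
  right_inv q := by simp
  continuous_toFun := by unfold Fin.tail; fun_prop
  continuous_invFun := by fun_prop

theorem cubeSplit_preimage (n : ℕ) :
    cubeSplit n ⁻¹' prismBoundary (Cube.boundary (Fin n)) = Cube.boundary (Fin (n + 1)) := by
  ext x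
  change ((∃ i : Fin n, x i.succ = 0 ∨ x i.succ = 1) ∨ (x 0 = 0 ∨ x 0 = 1)) ↔
    ∃ i, x i = 0 ∨ x i = 1
  rw [Fin.exists_fin_succ]
  exact or_comm

theorem isBoxPair_prism (n : ℕ) : IsBoxPair (prismBoundary (Cube.boundary (Fin n))) := by
  have h := (isBoxPair_cube (n + 1)).preimage (cubeSplit n).symm
  rwa [← cubeSplit_preimage, ← Set.preimage_comp, Homeomorph.self_comp_symm, Set.preimage_id] at h

instance contractibleSpace_unitInterval : ContractibleSpace I :=
  (convex_Icc (0 : ℝ) 1).contractibleSpace ⟨0, by simp⟩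

instance contractibleSpace_cube (n : ℕ) : ContractibleSpace (Fin n → I) := by
  induction n with
  | zero => infer_instance
  | succ n ih => exact (cubeSplit n).contractibleSpace

end Cube

/-! ### Spaces in which all loops are null homotopic -/

section NullLoops

/-- All maps `T → F` are homotopic to the constant map at `c`. -/
def NullMaps (T : Type u) [TopologicalSpace T] {F : Type w} [TopologicalSpace F] (c : F) : Prop :=
  ∀ f : T → F, Continuous f →
    ∃ H : T × I → F, Continuous H ∧ (∀ x, H (x, 0) = c) ∧ ∀ x, H (x, 1) = f x

/-- All generalized loops of `F` at `x₀` are null homotopic relative to the boundary, that is, `F`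
is weakly contractible. -/
def NullLoops (F : Type w) [TopologicalSpace F] (x₀ : F) : Prop :=
  ∀ (n : ℕ) (l : (Fin n → I) → F), Continuous l → (∀ x ∈ Cube.boundary (Fin n), l x = x₀) →
    ∃ N : (Fin n → I) × I → F, Continuous N ∧ (∀ x, N (x, 0) = x₀) ∧ (∀ x, N (x, 1) = l x) ∧
      ∀ x ∈ Cube.boundary (Fin n), ∀ t, N (x, t) = x₀

variable {T : Type u} [TopologicalSpace T] {F : Type w} [TopologicalSpace F]

theorem nullMaps_of_contractible [ContractibleSpace T] {c : F} (hc : ∀ y, Joined c y) :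
    NullMaps T c := by
  intro f hf
  obtain ⟨x₀, hx₀⟩ := id_nullhomotopic T
  have hjoin : (ContinuousMap.const T c).Homotopic (ContinuousMap.const T (f x₀)) :=
    ContinuousMap.homotopic_const_iff.2 (hc _)
  obtain ⟨H⟩ := hjoin.trans ((ContinuousMap.Homotopic.refl (⟨f, hf⟩ : C(T, F))).comp hx₀).symm
  exact ⟨fun z => H (z.2, z.1), by fun_prop, fun x => H.apply_zero x, fun x => H.apply_one x⟩

/-- A null homotopy of an extension of `ψ` from the box to the prism, restricted to the box, extends
over the top by the homotopy extension property. -/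
theorem IsBoxPair.exists_homotopy_prismBoundary {S : Set T} (hS : IsBoxPair S) {x₀ : F}
    (hnull : NullMaps (T × I) x₀) {ψ : T × I → F} (hψ : ContinuousOn ψ (prismBoundary S)) :
    ∃ K : (T × I) × I → F, ContinuousOn K (Prod.fst ⁻¹' prismBoundary S) ∧
      (∀ z ∈ prismBox S, K (z, 0) = x₀) ∧ ∀ z ∈ prismBoundary S, K (z, 1) = ψ z := by
  obtain ⟨ρ, cρ, hρ⟩ := hS.extend (hψ.mono (prismBox_subset_prismBoundary S))
  obtain ⟨G, cG, G0, G1⟩ := hnull ρ cρ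
  have ctop : Continuous fun x : T => ψ (x, 1) :=
    hψ.comp_continuous (by fun_prop) fun x => .inr (.inr rfl)
  obtain ⟨Q, cQ, Q0, QS⟩ := hS.extend_homotopy ctop
    (Q := fun z => G ((z.1, 1), unitInterval.symm z.2)) (by fun_prop) fun x hx => by
      simp only [unitInterval.symm_zero, G1, hρ (x, 1) (.inr hx)]
  refine ⟨fun q => if q.1.2 = 1 then Q (q.1.1, unitInterval.symm q.2) else G q,
    continuousOn_prismBoundary hS.isClosed (Q := fun z => Q (z.1, unitInterval.symm z.2))
      (by fun_prop) cG fun x hx t => ?_, ?_, ?_⟩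
  · rw [QS x hx, unitInterval.symm_symm]
  · rintro ⟨x, s⟩ hz
    dsimp only
    split_ifs with hs
    · subst hs
      rw [QS x (hz.resolve_left one_ne_zero), unitInterval.symm_symm, G0]
    · exact G0 _
  · rintro ⟨x, s⟩ hz
    dsimp only
    split_ifs with hs
    · rw [unitInterval.symm_one, Q0, hs]
    · rw [G1, hρ _ (hz.elim .inr fun h => .inl (h.resolve_right hs))]

namespace NullLoops

variable {x₀ : F} (h : NullLoops F x₀)
include h

theorem joined (x : F) : Joined x₀ x := by
  obtain ⟨N, cN, h0, h1, -⟩ := h 0 (fun _ => x) continuous_const (fun y ⟨i, _⟩ => i.elim0)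
  exact ⟨⟨⟨fun t => N (0, t), by fun_prop⟩, h0 0, h1 0⟩⟩

theorem fill_prism (n : ℕ) {ψ : (Fin n → I) × I → F}
    (hψ : ContinuousOn ψ (prismBoundary (Cube.boundary (Fin n)))) :
    ∃ g : (Fin n → I) × I → F, Continuous g ∧ ∀ z ∈ prismBoundary (Cube.boundary (Fin n)),
      g z = ψ z := by
  obtain ⟨K, cK, K0, K1⟩ := (isBoxPair_cube n).exists_homotopy_prismBoundary
    (nullMaps_of_contractible h.joined) hψ
  obtain ⟨N, cN, N0, N1, NS⟩ := h n (fun x => K ((x, 1), 0))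
    (cK.comp_continuous (by fun_prop) fun x => .inr (.inr rfl)) fun x hx => K0 _ (.inr hx)
  obtain ⟨L, cL, -, hL⟩ := (isBoxPair_prism n).extend_homotopy cN cK (by
    rintro ⟨x, t⟩ (hx | rfl | rfl)
    · rw [NS x hx, K0 _ (.inr hx)]
    · rw [N0, K0 _ (.inl rfl)]
    · rw [N1])
  exact ⟨fun z => L (z, 1), by fun_prop, fun z hz => (hL z hz 1).trans (K1 z hz)⟩

theorem fill (n : ℕ) {ψ : (Fin n → I) → F} (hψ : ContinuousOn ψ (Cube.boundary (Fin n))) :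
    ∃ g : (Fin n → I) → F, Continuous g ∧ ∀ x ∈ Cube.boundary (Fin n), g x = ψ x := by
  cases n with
  | zero => exact ⟨fun _ => x₀, continuous_const, fun x ⟨i, _⟩ => i.elim0⟩
  | succ n =>
    rw [← cubeSplit_preimage] at hψ ⊢
    obtain ⟨g, cg, hg⟩ := h.fill_prism n (ψ := ψ ∘ (cubeSplit n).symm)
      (hψ.comp (cubeSplit n).symm.continuous.continuousOn fun z hz => by simpa using hz)
    refine ⟨fun x => g (cubeSplit n x), cg.comp (cubeSplit n).continuous, fun x hx => ?_⟩
    simpa using hg _ hx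

end NullLoops

end NullLoops

/-! ### Lifting properties -/

section Lifting

variable {E : Type v} [TopologicalSpace E] {B : Type w} [TopologicalSpace B]

/-- The homotopy lifting property. -/
def HasHLP (p : E → B) : Prop :=
  ∀ (T : Type) [TopologicalSpace T] (e : T → E) (H : T × I → B), Continuous e → Continuous H →
    (∀ x, H (x, 0) = p (e x)) →
    ∃ L : T × I → E, Continuous L ∧ (∀ x, L (x, 0) = e x) ∧ ∀ z, p (L z) = H z

/-- The right lifting property of `p` with respect to the inclusion of `S`. -/
def HasRLP (p : E → B) {T : Type} [TopologicalSpace T] (S : Set T) : Prop :=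
  ∀ (f : T → B) (ψ : T → E), Continuous f → ContinuousOn ψ S → (∀ x ∈ S, p (ψ x) = f x) →
    ∃ g : T → E, Continuous g ∧ (∀ x, p (g x) = f x) ∧ ∀ x ∈ S, g x = ψ x

namespace HasHLP

variable {p : E → B} (hp : HasHLP p) {T : Type} [TopologicalSpace T] {S : Set T}
include hp

open Classical in
theorem lift_on {e : T → E} {H : T × I → B} (he : ContinuousOn e S) (hH : Continuous H)
    (h : ∀ x ∈ S, H (x, 0) = p (e x)) :
    ∃ L : T × I → E, ContinuousOn L (Prod.fst ⁻¹' S) ∧ (∀ x ∈ S, L (x, 0) = e x) ∧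
      ∀ x ∈ S, ∀ t, p (L (x, t)) = H (x, t) := by
  obtain ⟨L, cL, L0, L1⟩ := hp S (S.domRestrict e) (fun z => H (z.1, z.2))
    (continuousOn_iff_continuous_domRestrict.1 he) (by fun_prop) fun x => h x x.2
  let L' : T × I → E := fun z => if hz : z.1 ∈ S then L (⟨z.1, hz⟩, z.2) else e z.1
  have hL' : ∀ {x} (hx : x ∈ S) t, L' (x, t) = L (⟨x, hx⟩, t) := fun hx _ => dif_pos hx
  refine ⟨L', ?_, fun x hx => ?_, fun x hx t => ?_⟩
  · have hrestrict : Set.domRestrict (Prod.fst ⁻¹' S) L' =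
        fun z : ↥(Prod.fst ⁻¹' S : Set (T × I)) => L (⟨z.1.1, z.2⟩, z.1.2) :=
      funext fun z => hL' z.2 _
    rw [continuousOn_iff_continuous_domRestrict, hrestrict]
    exact cL.comp (by fun_prop)
  · rw [hL' hx, L0, Set.domRestrict_apply]
  · rw [hL' hx, L1]

theorem lift_rel (hS : IsBoxPair S) {e : T × I → E} {H : T × I → B}
    (he : ContinuousOn e (prismBox S)) (hH : Continuous H) (h : ∀ z ∈ prismBox S, p (e z) = H z) :
    ∃ L : T × I → E, Continuous L ∧ (∀ z, p (L z) = H z) ∧ ∀ z ∈ prismBox S, L z = e z := by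
  obtain ⟨D, φ, cD, cφ, h0, h1, h2⟩ := hS.exists_deformation
  obtain ⟨L, cL, L0, L1⟩ := hp (T × I) (fun z => e (D (z, 0))) (fun q => H (D q))
    (he.comp_continuous (by fun_prop) h0) (by fun_prop) fun z => (h _ (h0 z)).symm
  refine ⟨fun z => L (z, φ z), by fun_prop, fun z => (L1 _).trans (congrArg H (h1 z)),
    fun z hz => ?_⟩
  have hz0 : D (z, 0) = z := by rw [← h2 z hz, h1]
  dsimp only
  rw [h2 z hz, L0, hz0]

/-- The lifting problem is moved into the fibre over `c` along a null homotopy of the base map,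
solved there, and moved back. -/
theorem hasRLP (hS : IsBoxPair S) {c : B} (hc : NullMaps T c)
    (fill : ∀ ψ : T → E, ContinuousOn ψ S → (∀ x ∈ S, p (ψ x) = c) →
      ∃ g : T → E, Continuous g ∧ (∀ x, p (g x) = c) ∧ ∀ x ∈ S, g x = ψ x) : HasRLP p S := by
  classical
  intro f ψ hf hψ h
  obtain ⟨H, cH, H0, H1⟩ := hc f hf
  obtain ⟨L, cL, L0, L1⟩ := hp.lift_on hψ (H := fun z => H (z.1, unitInterval.symm z.2))
    (by fun_prop) fun x hx => by simp only [unitInterval.symm_zero, H1, h x hx]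
  obtain ⟨g, cg, gp, gS⟩ := fill (fun x => L (x, 1)) (cL.comp (by fun_prop) fun x hx => hx)
    fun x hx => by rw [L1 x hx, unitInterval.symm_one, H0]
  have cbox := continuousOn_prismBox hS.isClosed cg
    (Q := fun z => L (z.1, unitInterval.symm z.2)) (cL.comp (by fun_prop) fun z hz => hz)
    fun x hx => by simp only [unitInterval.symm_zero, gS x hx]
  obtain ⟨M, cM, Mp, MS⟩ := hp.lift_rel hS cbox cH (by
    rintro ⟨x, t⟩ hz
    dsimp only
    split_ifs with hx
    · rw [L1 x hx, unitInterval.symm_symm]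
    · obtain rfl : t = 0 := hz.resolve_right hx
      rw [H0, gp])
  refine ⟨fun x => M (x, 1), by fun_prop, fun x => (Mp _).trans (H1 x), fun x hx => ?_⟩
  dsimp only
  rw [MS _ (.inr hx), if_pos hx, unitInterval.symm_one, L0 x hx]

end HasHLP

end Lifting

/-! ### Lifting maps of relative CW complexes -/

section CellLifting

open Metric Set Topology.RelCWComplex

theorem HasRLP.extend_closedBall {E : Type v} [TopologicalSpace E] {B : Type w} [TopologicalSpace B]
    {p : E → B} {n : ℕ} (hp : HasRLP p (Cube.boundary (Fin n))) {f : (Fin n → ℝ) → B}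
    {ψ : (Fin n → ℝ) → E} (hf : ContinuousOn f (closedBall 0 1)) (hψ : ContinuousOn ψ (sphere 0 1))
    (h : ∀ x ∈ sphere (0 : Fin n → ℝ) 1, p (ψ x) = f x) :
    ∃ g : (Fin n → ℝ) → E, ContinuousOn g (closedBall 0 1) ∧
      (∀ x ∈ closedBall (0 : Fin n → ℝ) 1, p (g x) = f x) ∧ ∀ x ∈ sphere 0 1, g x = ψ x := by
  have hc := continuous_centred (n := n)
  have hball : ∀ x : Fin n → I, centred x ∈ closedBall (0 : Fin n → ℝ) 1 := fun x =>
    mem_closedBall_zero_iff.2 (norm_centred_le x)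
  have hsphere : ∀ x, centred x ∈ sphere (0 : Fin n → ℝ) 1 ↔ x ∈ Cube.boundary (Fin n) := fun x =>
    mem_sphere_zero_iff_norm.trans norm_centred_eq_one_iff
  obtain ⟨g, cg, gp, gψ⟩ := hp (fun x => f (centred x)) (fun x => ψ (centred x))
    (hf.comp_continuous hc hball) (hψ.comp hc.continuousOn fun x hx => (hsphere x).2 hx)
    fun x hx => h _ ((hsphere x).2 hx)
  let q : (Fin n → ℝ) → Fin n → I := fun x i => projIcc 0 1 zero_le_one ((x i + 1) / 2)
  have cq : Continuous q := by fun_prop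
  have hq : ∀ x ∈ closedBall (0 : Fin n → ℝ) 1, centred (q x) = x := by
    intro x hx
    funext i
    have hi := (norm_le_pi_norm x i).trans (mem_closedBall_zero_iff.1 hx)
    rw [Real.norm_eq_abs, abs_le] at hi
    change 2 * (projIcc (0 : ℝ) 1 zero_le_one ((x i + 1) / 2) : ℝ) - 1 = x i
    rw [projIcc_of_mem zero_le_one (⟨by linarith, by linarith⟩ : (x i + 1) / 2 ∈ Icc 0 1)]
    ring
  refine ⟨fun x => g (q x), (cg.comp cq).continuousOn, fun x hx => ?_, fun x hx => ?_⟩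
  · rw [gp, hq x hx]
  · have hqx := hq x (sphere_subset_closedBall hx)
    dsimp only
    rw [gψ _ ((hsphere _).1 (by rwa [hqx])), hqx]

theorem continuousOn_image_of_isCompact {P : Type u} [TopologicalSpace P] [T2Space P] {K : Type v}
    [TopologicalSpace K] [T2Space K] {E : Type w} [TopologicalSpace E] {S : Set P}
    (hS : IsCompact S) {χ : P → K} (hχ : ContinuousOn χ S) {g : K → E}
    (hg : ContinuousOn (g ∘ χ) S) : ContinuousOn g (χ '' S) := by
  rw [continuousOn_iff_isClosed]
  intro t ht
  have hclosed : IsClosed (S ∩ (g ∘ χ) ⁻¹' t) := hg.preimage_isClosed_of_isClosed hS.isClosed ht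
  refine ⟨χ '' (S ∩ (g ∘ χ) ⁻¹' t), ((hS.of_isClosed_subset hclosed
    inter_subset_left).image_of_continuousOn (hχ.mono inter_subset_left)).isClosed, ?_⟩
  ext x
  constructor
  · rintro ⟨hx, y, hy, rfl⟩
    exact ⟨⟨y, ⟨hy, hx⟩, rfl⟩, y, hy, rfl⟩
  · rintro ⟨⟨y, ⟨hy, hy'⟩, rfl⟩, -⟩
    exact ⟨hy', y, hy, rfl⟩

variable {K : Type u} [TopologicalSpace K]

section ModifyCells

variable {D : Set K} [Topology.RelCWComplex (univ : Set K) D] {E : Type v} {n : ℕ}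

theorem disjoint_closedCell_openCell [T2Space K] {m : ℕ} (h : m < n) (i : cell (univ : Set K) m)
    (j : cell (univ : Set K) n) : Disjoint (closedCell m i) (openCell n j) :=
  (disjoint_skeletonLT_openCell (n := ((m + 1 : ℕ) : ℕ∞)) (by exact_mod_cast h)).mono_left (by
    exact_mod_cast closedCell_subset_skeletonLT m i)

open Classical in
/-- The function `g`, changed on each open `n`-cell to the given function of the characteristic
coordinates of that cell. -/
def modifyCells (g : K → E) (h : cell (univ : Set K) n → (Fin n → ℝ) → E) (x : K) : E :=
  if hx : ∃ i : cell (univ : Set K) n, x ∈ openCell n i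
    then h hx.choose ((map n hx.choose).symm x) else g x

variable {g : K → E} {h : cell (univ : Set K) n → (Fin n → ℝ) → E}

theorem modifyCells_of_notMem {x : K} (hx : ∀ i : cell (univ : Set K) n, x ∉ openCell n i) :
    modifyCells g h x = g x :=
  dif_neg fun ⟨i, hi⟩ => hx i hi

theorem modifyCells_of_mem_base {x : K} (hx : x ∈ D) : modifyCells g h x = g x :=
  modifyCells_of_notMem fun i hi => disjoint_left.1 (disjointBase n i) hi hx

theorem modifyCells_of_mem_closedCell [T2Space K] {m : ℕ} (hm : m < n)
    {i : cell (univ : Set K) m} {x : K} (hx : x ∈ closedCell m i) : modifyCells g h x = g x :=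
  modifyCells_of_notMem fun j => disjoint_left.1 (disjoint_closedCell_openCell hm i j) hx

theorem modifyCells_map_of_mem_ball (i : cell (univ : Set K) n) {y : Fin n → ℝ}
    (hy : y ∈ ball 0 1) : modifyCells g h (map n i y) = h i y := by
  have hx : ∃ i' : cell (univ : Set K) n, map n i y ∈ openCell n i' := ⟨i, y, hy, rfl⟩
  have hi : hx.choose = i := by
    by_contra hne
    have hdisj := disjoint_openCell_of_ne (C := (univ : Set K)) (n := n) (m := n)
      (i := hx.choose) (j := i) fun h => hne (by simpa using h)
    exact disjoint_left.1 hdisj hx.choose_spec ⟨y, hy, rfl⟩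
  rw [modifyCells, dif_pos hx, hi, (map n i).left_inv (by rwa [source_eq])]

theorem modifyCells_map_of_mem_closedBall [T2Space K] (i : cell (univ : Set K) n)
    (hsphere : ∀ y ∈ sphere (0 : Fin n → ℝ) 1, h i y = g (map n i y)) {y : Fin n → ℝ}
    (hy : y ∈ closedBall 0 1) : modifyCells g h (map n i y) = h i y := by
  rcases (ball_union_sphere (x := (0 : Fin n → ℝ)) (ε := 1)).ge hy with hy | hy
  · exact modifyCells_map_of_mem_ball i hy
  · rw [hsphere y hy]
    obtain ⟨J, hJ⟩ := mapsTo (C := (univ : Set K)) n i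
    rcases hJ hy with hbase | hcell
    · exact modifyCells_of_mem_base hbase
    · simp only [mem_iUnion] at hcell
      obtain ⟨m, hm, j, -, hj⟩ := hcell
      exact modifyCells_of_mem_closedCell hm hj

end ModifyCells

variable {k₀ : K} [Topology.RelCWComplex (univ : Set K) {k₀}] {E : Type v}

section

variable [TopologicalSpace E] {B : Type w}

/-- A pointed lift of `f`, as a function, that is continuous on all cells of dimension less
than `n`. -/
structure PartialLift (p : E → B) (f : K → B) (e₀ : E) (k₀ : K)
    [Topology.RelCWComplex (univ : Set K) {k₀}] (n : ℕ) (g : K → E) : Prop where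
  lift : ∀ x, p (g x) = f x
  base : g k₀ = e₀
  cont : ∀ m < n, ∀ i : cell (univ : Set K) m, ContinuousOn (g ∘ map m i) (closedBall 0 1)

variable [TopologicalSpace B]

theorem exists_partialLift_zero {p : E → B}
    (hp : HasRLP p (Cube.boundary (Fin 0))) {f : K → B} {e₀ : E} (he : p e₀ = f k₀) :
    ∃ g, PartialLift p f e₀ k₀ 0 g := by
  classical
  have hsurj : p.Surjective := fun b => by
    obtain ⟨g, -, h, -⟩ := hp (fun _ => b) (fun _ => e₀) continuous_const continuousOn_const
      fun x ⟨i, _⟩ => i.elim0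
    exact ⟨g 0, h 0⟩
  choose r hr using hsurj
  refine ⟨Function.update (r ∘ f) k₀ e₀, fun x => ?_, Function.update_self .., fun m hm =>
    absurd hm (Nat.not_lt_zero m)⟩
  obtain rfl | hx := eq_or_ne x k₀
  · rw [Function.update_self, he]
  · rw [Function.update_of_ne hx, Function.comp_apply, hr]

end

variable [T2Space K]

/-- A sequence of functions that changes only on the open `n`-cells in its `n`-th step is stationary
on each closed cell. -/
theorem exists_stationary_limit {s : ℕ → K → E}
    (hs : ∀ n x, (∀ i : cell (univ : Set K) n, x ∉ openCell n i) → s (n + 1) x = s n x) :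
    ∃ g : K → E, (∀ x, ∃ n, g x = s n x) ∧
      ∀ m (i : cell (univ : Set K) m), ∀ x ∈ closedCell m i, g x = s (m + 1) x := by
  have hcell : ∀ {m} {i : cell (univ : Set K) m} {x}, x ∈ closedCell m i → ∀ n, m + 1 ≤ n →
      s n x = s (m + 1) x := by
    intro m i x hx n hn
    induction n, hn using Nat.le_induction with
    | base => rfl
    | succ n hn ih =>
      rw [hs n x fun j => disjoint_left.1 (disjoint_closedCell_openCell hn i j) hx, ih]
  have hbase : ∀ n, s n k₀ = s 0 k₀ := by
    intro n
    induction n with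
    | zero => rfl
    | succ n ih =>
      rw [hs n k₀ fun i hi => disjoint_left.1 (disjointBase (C := (univ : Set K)) n i) hi rfl, ih]
  have hstable : ∀ x, ∃ d, ∀ n, d ≤ n → s n x = s d x := by
    intro x
    have hx : x ∈ ({k₀} ∪ ⋃ (n : ℕ) (j : cell (univ : Set K) n), closedCell n j : Set K) := by
      rw [Topology.RelCWComplex.union]; trivial
    rcases hx with rfl | hx
    · exact ⟨0, fun n _ => hbase n⟩
    · simp only [mem_iUnion] at hx
      obtain ⟨m, i, hi⟩ := hx
      exact ⟨m + 1, hcell hi⟩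
  choose d hd using hstable
  refine ⟨fun x => s (d x) x, fun x => ⟨d x, rfl⟩, fun m i x hx => ?_⟩
  rw [← hcell hx _ (le_max_left (m + 1) (d x)), hd x _ (le_max_right (m + 1) (d x))]

theorem continuous_of_continuousOn_cells [TopologicalSpace E] {g : K → E}
    (hg : ∀ n (i : cell (univ : Set K) n), ContinuousOn (g ∘ map n i) (closedBall 0 1)) :
    Continuous g := by
  refine continuous_iff_isClosed.2 fun t ht => closed' (C := (univ : Set K)) _ (subset_univ _)
    ⟨fun n i => ?_, ((finite_singleton k₀).subset inter_subset_right).isClosed⟩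
  have hcell : ContinuousOn g (closedCell n i) :=
    continuousOn_image_of_isCompact (isCompact_closedBall 0 1) (continuousOn n i) (hg n i)
  rw [inter_comm]
  exact hcell.preimage_isClosed_of_isClosed isClosed_closedCell ht

variable [TopologicalSpace E] {B : Type w}

theorem PartialLift.continuousOn_sphere {p : E → B} {f : K → B} {e₀ : E} {n : ℕ} {g : K → E}
    (hg : PartialLift p f e₀ k₀ n g) (i : cell (univ : Set K) n) :
    ContinuousOn (g ∘ map n i) (sphere 0 1) := by
  obtain ⟨J, hJ⟩ := mapsTo (C := (univ : Set K)) n i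
  let ι := Σ m : Fin n, {j // j ∈ J m}
  have hcells : ContinuousOn g (⋃ q : ι, closedCell (C := (univ : Set K)) q.1 q.2.1) := by
    refine LocallyFinite.continuousOn_iUnion (locallyFinite_of_finite _)
      (fun q => isClosed_closedCell) fun q => ?_
    exact continuousOn_image_of_isCompact (isCompact_closedBall 0 1) (continuousOn _ _)
      (hg.cont _ q.1.2 _)
  have hskeleton :
      ContinuousOn g ({k₀} ∪ ⋃ q : ι, closedCell (C := (univ : Set K)) q.1 q.2.1) :=
    (continuousOn_singleton _ _).union_of_isClosed hcells isClosed_singleton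
      (isClosed_iUnion_of_finite fun q => isClosed_closedCell)
  refine hskeleton.comp ((continuousOn n i).mono sphere_subset_closedBall) (hJ.mono_right ?_)
  refine union_subset_union_right _ ?_
  simp only [iUnion_subset_iff]
  intro m hm j hj
  exact subset_iUnion (fun q : ι => closedCell (C := (univ : Set K)) q.1 q.2.1) ⟨⟨m, hm⟩, ⟨j, hj⟩⟩

variable [TopologicalSpace B] {p : E → B} (hp : ∀ n, HasRLP p (Cube.boundary (Fin n)))
include hp

theorem PartialLift.exists_succ {f : K → B} (hf : Continuous f) {e₀ : E} {n : ℕ} {g : K → E}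
    (hg : PartialLift p f e₀ k₀ n g) : ∃ g', PartialLift p f e₀ k₀ (n + 1) g' ∧
      ∀ x, (∀ i : cell (univ : Set K) n, x ∉ openCell n i) → g' x = g x := by
  choose h ch hlift hsphere using fun i : cell (univ : Set K) n => (hp n).extend_closedBall
    (f := f ∘ map n i) (hf.comp_continuousOn (continuousOn n i)) (hg.continuousOn_sphere i)
    (fun x _ => hg.lift _)
  refine ⟨modifyCells g h, ⟨fun x => ?_, (modifyCells_of_mem_base (mem_singleton k₀)).trans hg.base,
    fun m hm i => ?_⟩, fun x => modifyCells_of_notMem⟩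
  · by_cases hx : ∃ i : cell (univ : Set K) n, x ∈ openCell n i
    · obtain ⟨i, y, hy, rfl⟩ := hx
      rw [modifyCells_map_of_mem_ball i hy, hlift i y (ball_subset_closedBall hy),
        Function.comp_apply]
    · rw [modifyCells_of_notMem (not_exists.1 hx), hg.lift]
  · rcases Nat.lt_succ_iff_lt_or_eq.1 hm with hm | rfl
    · exact (hg.cont m hm i).congr fun y hy => modifyCells_of_mem_closedCell hm ⟨y, hy, rfl⟩
    · exact (ch i).congr fun y hy => modifyCells_map_of_mem_closedBall i (hsphere i) hy

theorem exists_lift_of_hasRLP {f : K → B} (hf : Continuous f) {e₀ : E} (he : p e₀ = f k₀) :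
    ∃ g : K → E, Continuous g ∧ (∀ x, p (g x) = f x) ∧ g k₀ = e₀ := by
  obtain ⟨g₀, h₀⟩ := exists_partialLift_zero (hp 0) he
  choose next hnext hoff using fun (n : ℕ) (g : K → E) (hg : PartialLift p f e₀ k₀ n g) =>
    hg.exists_succ hp hf
  let s : ∀ n : ℕ, {g : K → E // PartialLift p f e₀ k₀ n g} := fun n =>
    Nat.rec ⟨g₀, h₀⟩ (fun n g => ⟨next n g.1 g.2, hnext n g.1 g.2⟩) n
  obtain ⟨g, hpoint, hcell⟩ := exists_stationary_limit (k₀ := k₀) (s := fun n => (s n).1)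
    fun n x hx => hoff n (s n).1 (s n).2 x hx
  refine ⟨g, continuous_of_continuousOn_cells (k₀ := k₀) fun n i => ?_, fun x => ?_, ?_⟩
  · exact ((s (n + 1)).2.cont n n.lt_succ_self i).congr fun y hy => hcell n i _ ⟨y, hy, rfl⟩
  · obtain ⟨n, hn⟩ := hpoint x
    rw [hn, (s n).2.lift]
  · obtain ⟨n, hn⟩ := hpoint k₀
    rw [hn, (s n).2.base]

end CellLifting

/-! ### The mapping path space -/

section MapPath

variable {Z : Type u} [TopologicalSpace Z] {W : Type v} [TopologicalSpace W]

/-- The mapping path space of `u`: points `z` with a path that starts at `u z`. -/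
abbrev MapPath (u : Z → W) : Type max u v := {q : Z × C(I, W) // q.2 0 = u q.1}

namespace MapPath

/-- The end point of the path, the projection of the path fibration of `u`. -/
def endpt {u : Z → W} (q : MapPath u) : W := q.1.2 1

/-- The continuous family of points of the mapping path space with points `z x` and paths
`γ (x, ·)`. -/
def family {u : Z → W} {T : Type w} [TopologicalSpace T] (z : C(T, Z)) (γ : C(T × I, W))
    (h : ∀ x, γ (x, 0) = u (z x)) : C(T, MapPath u) :=
  ⟨fun x => ⟨(z x, γ.curry x), h x⟩, (z.continuous.prodMk γ.curry.continuous).subtype_mk _⟩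

variable {u : Z → W}

theorem continuous_endpt : Continuous (endpt : MapPath u → W) := by
  unfold endpt
  fun_prop

/-- The path of `e x` is prolonged by the part of the homotopy `H (x, ·)` up to time `s`, and the
concatenation is run through at speed `1 + s`. -/
theorem hasHLP (u : Z → W) : HasHLP (endpt : MapPath u → W) := by
  intro T _ e H he hH h
  let clamp : ℝ → I := Set.projIcc 0 1 zero_le_one
  have hclamp : Continuous clamp := continuous_projIcc
  have clamp_coe : ∀ t : I, clamp t = t := Set.projIcc_val _
  have clamp_zero : clamp 0 = 0 := clamp_coe 0
  have clamp_one : clamp 1 = 1 := clamp_coe 1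
  let γ : (T × I) × I → W := fun q => if (q.2 : ℝ) * (1 + q.1.2) ≤ 1
    then (e q.1.1).1.2 (clamp (q.2 * (1 + q.1.2)))
    else H (q.1.1, clamp (q.2 * (1 + q.1.2) - 1))
  have hγ : Continuous γ := by
    refine Continuous.if_le (by fun_prop) (by fun_prop) (by fun_prop) (by fun_prop) fun q hq => ?_
    rw [hq, sub_self, clamp_one, clamp_zero, h]
    rfl
  let L : C(T × I, MapPath u) := family ⟨fun q => (e q.1).1.1, by fun_prop⟩
    ⟨γ, hγ⟩ fun q => by
      simpa only [ContinuousMap.coe_mk, γ, Set.Icc.coe_zero, zero_mul, zero_le_one, if_true,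
        clamp_zero] using (e q.1).2
  refine ⟨L, L.continuous, fun x => Subtype.ext (Prod.ext rfl (ContinuousMap.ext fun t => ?_)),
    fun ⟨x, s⟩ => ?_⟩
  · change γ ((x, 0), t) = (e x).1.2 t
    simp only [γ, Set.Icc.coe_zero, add_zero, mul_one, t.2.2, if_true, clamp_coe]
  · change γ ((x, s), 1) = H (x, s)
    simp only [γ, Set.Icc.coe_one, one_mul, add_sub_cancel_left, clamp_coe]
    split_ifs with hs
    · obtain rfl : s = 0 := Subtype.ext (le_antisymm (by simpa using hs) s.2.1)
      rw [Set.Icc.coe_zero, add_zero, clamp_one, h]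
      rfl
    · rfl

end MapPath

/-- The homotopy fibre of `u` over `w`. -/
abbrev HoFiber (u : Z → W) (w : W) : Type max u v := {q : MapPath u // q.endpt = w}

theorem MapPath.hasRLP (u : Z → W) (c : W) (hc : ∀ w, Joined c w) {x₀ : HoFiber u c}
    (hF : NullLoops (HoFiber u c) x₀) (n : ℕ) :
    HasRLP (endpt : MapPath u → W) (Cube.boundary (Fin n)) := by
  classical
  refine (hasHLP u).hasRLP (isBoxPair_cube n) (nullMaps_of_contractible hc) fun ψ hψ hfib => ?_
  let ψ' : (Fin n → I) → HoFiber u c := fun x => if h : (ψ x).endpt = c then ⟨ψ x, h⟩ else x₀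
  have ψ'_val : ∀ x ∈ Cube.boundary (Fin n), (ψ' x).1 = ψ x := fun x hx =>
    congrArg Subtype.val (dif_pos (hfib x hx))
  have hψ' : ContinuousOn ψ' (Cube.boundary (Fin n)) :=
    Topology.IsInducing.subtypeVal.continuousOn_iff.2 (hψ.congr ψ'_val)
  obtain ⟨g, cg, hg⟩ := hF.fill n hψ'
  exact ⟨fun x => (g x).1, continuous_subtype_val.comp cg, fun x => (g x).2,
    fun x hx => (congrArg Subtype.val (hg x hx)).trans (ψ'_val x hx)⟩

namespace HoFiber

/-- The continuous family of points of the homotopy fibre with points `z x` and paths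
`γ (x, ·)`. -/
def family {u : Z → W} {w : W} {T : Type*} [TopologicalSpace T] (z : C(T, Z)) (γ : C(T × I, W))
    (h : ∀ x, γ (x, 0) = u (z x)) (h' : ∀ x, γ (x, 1) = w) : C(T, HoFiber u w) :=
  ⟨fun x => ⟨MapPath.family z γ h x, h' x⟩, (MapPath.family z γ h).continuous.subtype_mk _⟩

/-- The point of the homotopy fibre given by a path from `u z` to `w`. -/
def ofPath {u : Z → W} {z : Z} {w : W} (γ : Path (u z) w) : HoFiber u w :=
  ⟨⟨(z, γ.toContinuousMap), γ.source⟩, γ.target⟩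

/-- The base point of the homotopy fibre: the point `z₀` with the constant path. -/
def base (u : Z → W) (z₀ : Z) : HoFiber u (u z₀) := ofPath (Path.refl (u z₀))

variable {u : Z → W}

theorem joined_ofPath_of_homotopic {z : Z} {w : W} {γ γ' : Path (u z) w} (h : γ.Homotopic γ') :
    Joined (ofPath γ) (ofPath γ') := by
  obtain ⟨K⟩ := h
  exact ⟨{
    toContinuousMap := family (.const I z) K.toContinuousMap (fun s => K.source s)
      fun s => K.target s
    source' := Subtype.ext <| Subtype.ext <| Prod.ext rfl <| ContinuousMap.ext K.apply_zero
    target' := Subtype.ext <| Subtype.ext <| Prod.ext rfl <| ContinuousMap.ext K.apply_one }⟩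

theorem joined_ofPath_map_base (hu : Continuous u) {z z₀ : Z} (ζ : Path z z₀) :
    Joined (ofPath (ζ.map hu)) (base u z₀) :=
  ⟨{toContinuousMap := family ζ.toContinuousMap ⟨fun q => u (ζ (max q.1 q.2)), by fun_prop⟩
      (fun s => congrArg (fun t => u (ζ t)) (max_eq_left unitInterval.nonneg'))
      fun s => (congrArg (fun t => u (ζ t)) (max_eq_right unitInterval.le_one')).trans
        (congrArg u ζ.target)
    source' := Subtype.ext <| Subtype.ext <| Prod.ext ζ.source <| ContinuousMap.ext fun t =>
      congrArg (fun t => u (ζ t)) (max_eq_right unitInterval.nonneg')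
    target' := Subtype.ext <| Subtype.ext <| Prod.ext ζ.target <| ContinuousMap.ext fun t =>
      (congrArg (fun t => u (ζ t)) (max_eq_left unitInterval.le_one')).trans
        (congrArg u ζ.target) }⟩

section Base

variable (hu : Continuous u) {z₀ : Z} (hjoin : ∀ z, Joined (u z) (u z₀) → Joined z z₀)
  (hloop : ∀ δ : Path (u z₀) (u z₀), ∃ ζ : Path z₀ z₀, (ζ.map hu).Homotopic δ)
include hjoin hloop

theorem exists_path_map_homotopic {z : Z} (γ : Path (u z) (u z₀)) :
    ∃ ζ : Path z z₀, (ζ.map hu).Homotopic γ := by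
  obtain ⟨α⟩ := hjoin z ⟨γ⟩
  obtain ⟨β, hβ⟩ := hloop ((α.map hu).symm.trans γ)
  refine ⟨α.trans β, ?_⟩
  rw [Path.map_trans]
  calc ((α.map hu).trans (β.map hu)).Homotopic ((α.map hu).trans ((α.map hu).symm.trans γ)) :=
        (Path.Homotopic.refl _).hcomp hβ
    Path.Homotopic _ (((α.map hu).trans (α.map hu).symm).trans γ) :=
        ⟨(Path.Homotopy.transAssoc _ _ _).symm⟩
    Path.Homotopic _ ((Path.refl _).trans γ) :=
        .hcomp ⟨(Path.Homotopy.reflTransSymm _).symm⟩ (.refl γ)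
    Path.Homotopic _ γ := ⟨Path.Homotopy.reflTrans γ⟩

theorem joined_base (q : HoFiber u (u z₀)) : Joined (base u z₀) q := by
  let γ : Path (u q.1.1.1) (u z₀) := ⟨q.1.1.2, q.1.2, q.2⟩
  obtain ⟨ζ, hζ⟩ := exists_path_map_homotopic hu hjoin hloop γ
  exact (joined_ofPath_map_base hu ζ).symm.trans (joined_ofPath_of_homotopic hζ)

end Base

end HoFiber

end MapPath

/-! ### Powers of generalized loops -/

section PathHomotopy

variable {X : Type u} [TopologicalSpace X] {x y : X}

theorem continuous_path_of_family {T : Type v} [TopologicalSpace T] {L : T → Path x y}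
    (h : Continuous fun q : T × I => L q.1 q.2) : Continuous L :=
  Path.continuous_uncurry_iff.1 h

theorem joined_path_iff_homotopic {γ γ' : Path x y} : Joined γ γ' ↔ γ.Homotopic γ' := by
  constructor
  · rintro ⟨Γ⟩
    refine ⟨⟨⟨⟨fun q => Γ q.1 q.2, by fun_prop⟩, fun t => ?_, fun t => ?_⟩, ?_⟩⟩
    · exact congrArg (fun l : Path x y => l t) Γ.source
    · exact congrArg (fun l : Path x y => l t) Γ.target
    · rintro s t (rfl | rfl)
      exacts [(Γ s).source.trans γ.source.symm, (Γ s).target.trans γ.target.symm]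
  · rintro ⟨H⟩
    exact ⟨⟨⟨H.eval, continuous_path_of_family H.continuous⟩, H.eval_zero, H.eval_one⟩⟩

end PathHomotopy

section GenLoops

variable {Y : Type u} [TopologicalSpace Y] {y₀ : Y} {k : ℕ}

theorem continuous_genLoop_of_family {T : Type v} [TopologicalSpace T]
    {L : T → GenLoop (Fin k) Y y₀} (h : Continuous fun q : T × (Fin k → I) => L q.1 q.2) :
    Continuous L :=
  Continuous.subtype_mk (f := fun t => (L t).1)
    (ContinuousMap.continuous_of_continuous_uncurry _ h) _

theorem joined_iff_homotopic {f g : GenLoop (Fin k) Y y₀} :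
    Joined f g ↔ GenLoop.Homotopic f g := by
  constructor
  · rintro ⟨γ⟩
    refine ⟨⟨⟨⟨fun q => γ q.1 q.2, by fun_prop⟩, fun x => ?_, fun x => ?_⟩, fun t x hx => ?_⟩⟩
    · exact congrArg (fun l : GenLoop (Fin k) Y y₀ => l x) γ.source
    · exact congrArg (fun l : GenLoop (Fin k) Y y₀ => l x) γ.target
    · exact ((γ t).2 x hx).trans (f.2 x hx).symm
  · rintro ⟨H⟩
    refine ⟨⟨⟨fun t => ⟨⟨fun x => H (t, x), by fun_prop⟩, fun x hx => ?_⟩, ?_⟩, ?_, ?_⟩⟩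
    · exact (H.eq_fst t hx).trans (f.2 x hx)
    · exact continuous_genLoop_of_family H.continuous
    · exact GenLoop.ext _ _ fun x => H.apply_zero x
    · exact GenLoop.ext _ _ fun x => H.apply_one x

theorem genLoop_update_endpoint (l : GenLoop (Fin k) Y y₀) (i : Fin k) (x : Fin k → I) {t : I}
    (ht : t = 0 ∨ t = 1) : l (Function.update x i t) = y₀ :=
  l.2 _ ⟨i, by simpa using ht⟩

theorem continuous_genLoop_wrap (i : Fin k) (N : ℕ) :
    Continuous fun q : GenLoop (Fin k) Y y₀ × (Fin k → I) =>
      q.1 (Function.update q.2 i (wrap N (q.2 i))) := by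
  have := continuous_comp_wrap (T := GenLoop (Fin k) Y y₀ × (Fin k → I))
    (F := fun q => q.1.1 (Function.update q.1.2 i q.2)) (by fun_prop) (fun q => by
      dsimp only
      rw [genLoop_update_endpoint _ _ _ (.inl rfl), genLoop_update_endpoint _ _ _ (.inr rfl)]) N
  exact this.comp (by fun_prop : Continuous fun q : GenLoop (Fin k) Y y₀ × (Fin k → I) =>
    (q, q.2 i))

/-- The power map on generalized loops, formed with the `i`-th coordinate. -/
def genWrap (i : Fin k) (N : ℕ) (l : GenLoop (Fin k) Y y₀) : GenLoop (Fin k) Y y₀ :=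
  ⟨⟨fun x => l (Function.update x i (wrap N (x i))), (continuous_genLoop_wrap i N).comp
      (by fun_prop : Continuous fun x : Fin k → I => (l, x))⟩, by
    rintro x ⟨j, hj⟩
    change l _ = y₀
    by_cases hji : j = i
    · subst hji
      refine genLoop_update_endpoint _ _ _ (.inl ?_)
      rcases hj with hj | hj <;> rw [hj]
      exacts [wrap_zero N, wrap_one N]
    · exact l.2 _ ⟨j, by simpa [Function.update_of_ne hji] using hj⟩⟩

theorem genWrap_apply (i : Fin k) (N : ℕ) (l : GenLoop (Fin k) Y y₀) (x : Fin k → I) :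
    genWrap i N l x = l (Function.update x i (wrap N (x i))) := rfl

theorem continuous_genWrap (i : Fin k) (N : ℕ) :
    Continuous (genWrap i N : GenLoop (Fin k) Y y₀ → GenLoop (Fin k) Y y₀) :=
  continuous_genLoop_of_family (continuous_genLoop_wrap i N)

/-- The class of a generalized loop in the homotopy group. -/
def genCls (l : GenLoop (Fin k) Y y₀) : HomotopyGroup (Fin k) Y y₀ := Quotient.mk _ l

theorem genCls_eq_iff {l l' : GenLoop (Fin k) Y y₀} : genCls l = genCls l' ↔ Joined l l' :=
  Quotient.eq.trans joined_iff_homotopic.symm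

theorem genCls_pow [Nonempty (Fin k)] (i : Fin k) (N : ℕ) (l : GenLoop (Fin k) Y y₀) :
    genCls l ^ N = genCls (genWrap i N l) := by
  induction N with
  | zero =>
    rw [pow_zero, HomotopyGroup.one_def]
    refine congrArg genCls (GenLoop.ext _ _ fun x => ?_)
    rw [genWrap_apply, wrap, genLoop_update_endpoint _ _ _ (.inl rfl)]
    rfl
  | succ N ih =>
    rw [pow_succ, ih]
    refine (HomotopyGroup.mul_spec (i := i)).trans
      (congrArg genCls (GenLoop.ext _ _ fun x => ?_))
    rw [genWrap_apply, wrap]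
    change (if (x i : ℝ) ≤ 1 / 2 then _ else _) = _
    split_ifs
    · rfl
    · rw [genWrap_apply, Function.update_self, Function.update_idem]
      rfl

theorem joined_const_of_pow_injective [Nonempty (Fin k)] {N : ℕ} (i : Fin k)
    (h : Function.Injective fun g : HomotopyGroup (Fin k) Y y₀ => g ^ N)
    (l : GenLoop (Fin k) Y y₀) (hl : Joined (genWrap i N l) (genWrap i N GenLoop.const)) :
    Joined l GenLoop.const := by
  rw [← genCls_eq_iff, ← genCls_pow, ← genCls_pow] at hl
  exact genCls_eq_iff.1 (h hl)

theorem mem_boundary_succ_iff {x : Fin (k + 1) → I} : x ∈ Cube.boundary (Fin (k + 1)) ↔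
    (x 0 = 0 ∨ x 0 = 1) ∨ Fin.tail x ∈ Cube.boundary (Fin k) :=
  Fin.exists_fin_succ

theorem cons_mem_boundary {t : I} {x : Fin k → I}
    (h : (t = 0 ∨ t = 1) ∨ x ∈ Cube.boundary (Fin k)) :
    (Fin.cons t x : Fin (k + 1) → I) ∈ Cube.boundary (Fin (k + 1)) :=
  mem_boundary_succ_iff.2 h

theorem genWrap_succ_cons (i : Fin k) (N : ℕ) (l : GenLoop (Fin (k + 1)) Y y₀) (t : I)
    (x : Fin k → I) : genWrap i.succ N l (Fin.cons t x) =
      l (Fin.cons t (Function.update x i (wrap N (x i)))) := by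
  rw [genWrap_apply, Fin.cons_succ, ← Fin.cons_update]

theorem genWrap_zero_cons (N : ℕ) (l : GenLoop (Fin (k + 1)) Y y₀) (t : I) (x : Fin k → I) :
    genWrap 0 N l (Fin.cons t x) = l (Fin.cons (wrap N t) x) := by
  rw [genWrap_apply, Fin.cons_zero, Fin.update_cons_zero]

/-- The generalized loop given by a map from a prism, whose height is the first coordinate. -/
def prismLoop (F : C(I × (Fin k → I), Y))
    (hF : ∀ t x, (t = 0 ∨ t = 1) ∨ x ∈ Cube.boundary (Fin k) → F (t, x) = y₀) :
    GenLoop (Fin (k + 1)) Y y₀ :=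
  ⟨⟨fun x => F (x 0, Fin.tail x), by unfold Fin.tail; fun_prop⟩,
    fun _ hx => hF _ _ (mem_boundary_succ_iff.1 hx)⟩

/-! ### Loops of generalized loops -/

/-- A generalized loop as a loop of generalized loops parametrised by the first coordinate. -/
def pathOfLoop (l : GenLoop (Fin (k + 1)) Y y₀) :
    Path (GenLoop.const : GenLoop (Fin k) Y y₀) GenLoop.const where
  toFun t := ⟨⟨fun x => l (Fin.cons t x), by fun_prop⟩,
    fun _ hx => l.2 _ (cons_mem_boundary (.inr hx))⟩
  continuous_toFun := continuous_genLoop_of_family <| by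
    change Continuous fun q : I × (Fin k → I) => l (Fin.cons q.1 q.2)
    fun_prop
  source' := GenLoop.ext _ _ fun _ => l.2 _ (cons_mem_boundary (.inl (.inl rfl)))
  target' := GenLoop.ext _ _ fun _ => l.2 _ (cons_mem_boundary (.inl (.inr rfl)))

theorem continuous_pathOfLoop :
    Continuous (pathOfLoop : GenLoop (Fin (k + 1)) Y y₀ → Path GenLoop.const GenLoop.const) :=
  continuous_path_of_family <| continuous_genLoop_of_family <| by
    change Continuous fun q : (GenLoop (Fin (k + 1)) Y y₀ × I) × (Fin k → I) =>
      q.1.1 (Fin.cons q.1.2 q.2)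
    fun_prop

theorem pathOfLoop_surjective : Function.Surjective
    (pathOfLoop : GenLoop (Fin (k + 1)) Y y₀ → Path GenLoop.const GenLoop.const) := fun δ =>
  ⟨prismLoop ⟨fun q => δ q.1 q.2, by fun_prop⟩ <| by
    rintro t x ((rfl | rfl) | hx)
    exacts [congrArg (fun l : GenLoop (Fin k) Y y₀ => l x) δ.source,
      congrArg (fun l : GenLoop (Fin k) Y y₀ => l x) δ.target, (δ t).2 x hx], rfl⟩

theorem pathOfLoop_genWrap (i : Fin k) (N : ℕ) (l : GenLoop (Fin (k + 1)) Y y₀) :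
    pathOfLoop (genWrap i.succ N l) = (pathOfLoop l).map (continuous_genWrap i N) :=
  Path.ext <| funext fun t => GenLoop.ext _ _ <| genWrap_succ_cons i N l t

theorem exists_map_genWrap_homotopic {N : ℕ} (i : Fin k)
    (h : Function.Surjective fun g : HomotopyGroup (Fin (k + 1)) Y y₀ => g ^ N)
    (δ : Path (genWrap i N (GenLoop.const : GenLoop (Fin k) Y y₀)) (genWrap i N GenLoop.const)) :
    ∃ ζ : Path (GenLoop.const : GenLoop (Fin k) Y y₀) GenLoop.const,
      (ζ.map (continuous_genWrap i N)).Homotopic δ := by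
  obtain ⟨θ, rfl⟩ := pathOfLoop_surjective δ
  obtain ⟨c, hc⟩ := h (genCls θ)
  obtain ⟨l, rfl⟩ : ∃ l, genCls l = c := Quotient.exists_rep c
  have hjoin : Joined (genWrap i.succ N l) θ :=
    genCls_eq_iff.1 ((genCls_pow i.succ N l).symm.trans hc)
  refine ⟨pathOfLoop l, ?_⟩
  rw [← pathOfLoop_genWrap]
  exact joined_path_iff_homotopic.1 (hjoin.map continuous_pathOfLoop)

/-! ### Powers of loops -/

theorem continuous_path_wrap (N : ℕ) : Continuous fun q : Path y₀ y₀ × I => q.1 (wrap N q.2) :=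
  continuous_comp_wrap (F := fun q : Path y₀ y₀ × I => q.1 q.2) (by fun_prop)
    (fun l => by simp only [Path.source, Path.target]) N

/-- The power map on loops. -/
def pathWrap (N : ℕ) (l : Path y₀ y₀) : Path y₀ y₀ where
  toFun t := l (wrap N t)
  continuous_toFun := (continuous_path_wrap N).comp (by fun_prop : Continuous fun t : I => (l, t))
  source' := by rw [wrap_zero, l.source]
  target' := by rw [wrap_one, l.source]

theorem continuous_pathWrap (N : ℕ) : Continuous (pathWrap N : Path y₀ y₀ → Path y₀ y₀) :=
  continuous_path_of_family (continuous_path_wrap N)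

/-- A generalized loop as a generalized loop of loops: the loops run along the first
coordinate. -/
def slices : GenLoop (Fin (k + 1)) Y y₀ ≃ₜ GenLoop (Fin k) (Path y₀ y₀) (Path.refl y₀) where
  toFun l :=
    ⟨⟨fun x =>
      { toFun := fun t => l (Fin.cons t x)
        continuous_toFun := by fun_prop
        source' := l.2 _ (cons_mem_boundary (.inl (.inl rfl)))
        target' := l.2 _ (cons_mem_boundary (.inl (.inr rfl))) },
      continuous_path_of_family <| by
        change Continuous fun q : (Fin k → I) × I => l (Fin.cons q.2 q.1)
        fun_prop⟩,
    fun _ hx => Path.ext <| funext fun _ => l.2 _ (cons_mem_boundary (.inr hx))⟩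
  invFun m := prismLoop ⟨fun q => m q.2 q.1, by fun_prop⟩ <| by
    rintro t x ((rfl | rfl) | hx)
    exacts [(m x).source, (m x).target, congrArg (fun l : Path y₀ y₀ => l t) (m.2 x hx)]
  left_inv l := GenLoop.ext _ _ fun x => congrArg l (Fin.cons_self_tail x)
  right_inv _ := rfl
  continuous_toFun := continuous_genLoop_of_family <| continuous_path_of_family <| by
    change Continuous fun q : (GenLoop (Fin (k + 1)) Y y₀ × (Fin k → I)) × I =>
      q.1.1 (Fin.cons q.2 q.1.2)
    fun_prop
  continuous_invFun := continuous_genLoop_of_family <| by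
    change Continuous fun q : GenLoop (Fin k) (Path y₀ y₀) (Path.refl y₀) × (Fin (k + 1) → I) =>
      q.1 (Fin.tail q.2) (q.2 0)
    unfold Fin.tail
    fun_prop

theorem slices_genWrap (N : ℕ) (l : GenLoop (Fin (k + 1)) Y y₀) (x : Fin k → I) :
    slices (genWrap 0 N l) x = pathWrap N (slices l x) :=
  Path.ext <| funext fun t => genWrap_zero_cons N l t x

variable {N : ℕ}

/-- A point of the homotopy fibre of the power map on `(k + 1)`-dimensional loops, sliced into
points of the homotopy fibre of the power map on loops. -/
def fiberSlice :
    C(HoFiber (genWrap 0 N) (genWrap 0 N (GenLoop.const : GenLoop (Fin (k + 1)) Y y₀)) ×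
        (Fin k → I), HoFiber (pathWrap N) (pathWrap N (Path.refl y₀))) :=
  HoFiber.family ⟨fun q => slices q.1.1.1.1 q.2, by fun_prop⟩
    ⟨fun q => slices (q.1.1.1.1.2 q.2) q.1.2, by fun_prop⟩
    (fun q => (congrArg (fun l => slices l q.2) q.1.1.2).trans (slices_genWrap N _ _))
    fun q => congrArg (fun l => slices l q.2) q.1.2

theorem fiberSlice_base (x : Fin k → I) :
    fiberSlice (HoFiber.base (genWrap 0 N) (GenLoop.const : GenLoop (Fin (k + 1)) Y y₀), x) =
      HoFiber.base (pathWrap N) (Path.refl y₀) := rfl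

theorem fiberSlice_of_mem_boundary
    (q : HoFiber (genWrap 0 N) (genWrap 0 N (GenLoop.const : GenLoop (Fin (k + 1)) Y y₀)))
    {x : Fin k → I} (hx : x ∈ Cube.boundary (Fin k)) :
    fiberSlice (q, x) = HoFiber.base (pathWrap N) (Path.refl y₀) :=
  Subtype.ext <| Subtype.ext <| Prod.ext ((slices _).2 x hx) <|
    ContinuousMap.ext fun _ => (slices _).2 x hx

theorem exists_fiberSlice_eq (l : GenLoop (Fin k) (HoFiber (pathWrap N) (pathWrap N _))
      (HoFiber.base (pathWrap N) (Path.refl y₀))) :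
    ∃ q : HoFiber (genWrap 0 N) (genWrap 0 N (GenLoop.const : GenLoop (Fin (k + 1)) Y y₀)),
      ∀ x, fiberSlice (q, x) = l x := by
  let point : GenLoop (Fin k) (Path y₀ y₀) (Path.refl y₀) :=
    ⟨⟨fun x => (l x).1.1.1, by fun_prop⟩, fun x hx => congrArg (fun q => q.1.1.1) (l.2 x hx)⟩
  let path : I → GenLoop (Fin k) (Path y₀ y₀) (Path.refl y₀) := fun s =>
    ⟨⟨fun x => (l x).1.1.2 s, by fun_prop⟩, fun x hx => congrArg (fun q => q.1.1.2 s) (l.2 x hx)⟩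
  have cpath : Continuous path := continuous_genLoop_of_family <| by
    change Continuous fun q : I × (Fin k → I) => ((fun q => q.1.1.2) ∘ l.1) q.2 q.1
    fun_prop
  refine ⟨⟨⟨(slices.symm point, ⟨fun s => slices.symm (path s), by fun_prop⟩), ?_⟩, ?_⟩,
    fun x => rfl⟩
  · exact slices.injective <| GenLoop.ext _ _ fun x =>
      (l x).1.2.trans (slices_genWrap N (slices.symm point) x).symm
  · exact slices.injective <| GenLoop.ext _ _ fun x => (l x).2

/-- A loop in the homotopy fibre of the power map on `ΩY` is a point of the homotopy fibre of the
power map on the space of loops of one dimension more, and that space is path connected. -/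
theorem nullLoops_hoFiber_pathWrap
    (h : ∀ m, Function.Bijective fun g : HomotopyGroup (Fin (m + 1)) Y y₀ => g ^ N) :
    NullLoops (HoFiber (pathWrap N) _) (HoFiber.base (pathWrap N) (Path.refl y₀)) := by
  intro n l cl hl
  obtain ⟨q, hq⟩ := exists_fiberSlice_eq ⟨⟨l, cl⟩, hl⟩
  obtain ⟨γ⟩ := HoFiber.joined_base (continuous_genWrap 0 N)
    (joined_const_of_pow_injective 0 (h n).1) (exists_map_genWrap_homotopic 0 (h (n + 1)).2) q
  exact ⟨fun z => fiberSlice (γ z.2, z.1), by fun_prop,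
    fun x => (congrArg (fun q => fiberSlice (q, x)) γ.source).trans (fiberSlice_base x),
    fun x => (congrArg (fun q => fiberSlice (q, x)) γ.target).trans (hq x),
    fun x hx t => fiberSlice_of_mem_boundary _ hx⟩

theorem hasRLP_pathWrap [SimplyConnectedSpace Y]
    (h : ∀ m, Function.Bijective fun g : HomotopyGroup (Fin (m + 1)) Y y₀ => g ^ N) (n : ℕ) :
    HasRLP (MapPath.endpt : MapPath (pathWrap N : Path y₀ y₀ → Path y₀ y₀) → Path y₀ y₀)
      (Cube.boundary (Fin n)) :=
  MapPath.hasRLP _ _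
    (fun _ => joined_path_iff_homotopic.2 (SimplyConnectedSpace.paths_homotopic _ _))
    (nullLoops_hoFiber_pathWrap h) n

end GenLoops

/-! ### Lifting of homotopies -/

section PathEnds

theorem HasRLP.of_homeomorph {E : Type u} [TopologicalSpace E] {B : Type v} [TopologicalSpace B]
    {p : E → B} {T T' : Type} [TopologicalSpace T] [TopologicalSpace T'] {S : Set T} (h : T' ≃ₜ T)
    (hp : HasRLP p (h ⁻¹' S)) : HasRLP p S := by
  intro f ψ hf hψ hc
  obtain ⟨g, cg, hg, gS⟩ := hp (f ∘ h) (ψ ∘ h) (hf.comp h.continuous)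
    (hψ.comp h.continuous.continuousOn fun x hx => hx) fun x hx => hc _ hx
  refine ⟨g ∘ h.symm, cg.comp h.symm.continuous, fun x => ?_, fun x hx => ?_⟩
  · simp only [Function.comp_apply, hg, h.apply_symm_apply]
  · simpa only [Function.comp_apply, h.apply_symm_apply] using gS (h.symm x) (by simpa using hx)

theorem exists_continuousOn_prismBoundary {T : Type v} [TopologicalSpace T] {S : Set T}
    (hS : IsClosed S) {E : Type u} [TopologicalSpace E] {e₀ e₁ : T → E} {ψ : T → C(I, E)}
    (he₀ : Continuous e₀) (he₁ : Continuous e₁) (hψ : ContinuousOn ψ S)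
    (h₀ : ∀ x ∈ S, ψ x 0 = e₀ x) (h₁ : ∀ x ∈ S, ψ x 1 = e₁ x) :
    ∃ Ψ : T × I → E, ContinuousOn Ψ (prismBoundary S) ∧ (∀ x, Ψ (x, 0) = e₀ x) ∧
      (∀ x, Ψ (x, 1) = e₁ x) ∧ ∀ x ∈ S, ∀ t, Ψ (x, t) = ψ x t := by
  classical
  let Ψ : T × I → E := fun z =>
    if z.2 = 0 then e₀ z.1 else if z.2 = 1 then e₁ z.1 else ψ z.1 z.2
  have hΨ₀ : ∀ x, Ψ (x, 0) = e₀ x := fun x => if_pos rfl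
  have hΨ₁ : ∀ x, Ψ (x, 1) = e₁ x := fun x => (if_neg one_ne_zero).trans (if_pos rfl)
  have hΨS : ∀ x ∈ S, ∀ t, Ψ (x, t) = ψ x t := by
    intro x hx t
    dsimp only [Ψ]
    split_ifs with ht ht
    exacts [ht ▸ (h₀ x hx).symm, ht ▸ (h₁ x hx).symm, rfl]
  refine ⟨Ψ, ?_, hΨ₀, hΨ₁, hΨS⟩
  have hbot : IsClosed {z : T × I | z.2 = 0} := isClosed_eq continuous_snd continuous_const
  have htop : IsClosed {z : T × I | z.2 = 1} := isClosed_eq continuous_snd continuous_const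
  change ContinuousOn Ψ (Prod.fst ⁻¹' S ∪ ({z | z.2 = 0} ∪ {z | z.2 = 1}))
  refine ContinuousOn.union_of_isClosed ?_ (ContinuousOn.union_of_isClosed ?_ ?_ hbot htop)
    (hS.preimage continuous_fst) (hbot.union htop)
  · have hside : ContinuousOn (fun z : T × I => ψ z.1) (Prod.fst ⁻¹' S) :=
      hψ.comp continuousOn_fst fun z hz => hz
    exact (continuous_eval.comp_continuousOn (hside.prodMk continuousOn_snd)).congr
      fun z hz => hΨS z.1 hz z.2
  · refine (he₀.comp continuous_fst).continuousOn.congr ?_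
    rintro ⟨x, t⟩ rfl
    exact hΨ₀ x
  · refine (he₁.comp continuous_fst).continuousOn.congr ?_
    rintro ⟨x, t⟩ rfl
    exact hΨ₁ x

variable {E : Type u} [TopologicalSpace E] {B : Type v} [TopologicalSpace B] {p : E → B}

/-- The space of paths in the base of `p` with lifts of the two end points. -/
abbrev PathEnds (p : E → B) : Type max u v :=
  {q : (E × E) × C(I, B) // q.2 0 = p q.1.1 ∧ q.2 1 = p q.1.2}

/-- The projection of a path in the total space of `p`, with its end points. -/
def toPathEnds (hp : Continuous p) (β : C(I, E)) : PathEnds p :=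
  ⟨((β 0, β 1), ContinuousMap.comp ⟨p, hp⟩ β), rfl, rfl⟩

theorem HasRLP.toPathEnds (hp : Continuous p) {T : Type} [TopologicalSpace T] {S : Set T}
    (hS : IsClosed S) (h : HasRLP p (prismBoundary S)) : HasRLP (toPathEnds hp) S := by
  intro f ψ hf hψ hc
  have cf := continuous_subtype_val.comp hf
  obtain ⟨Ψ, cΨ, hΨ₀, hΨ₁, hΨS⟩ := exists_continuousOn_prismBoundary hS cf.fst.fst cf.fst.snd hψ
    (fun x hx => congrArg (fun q : PathEnds p => q.1.1.1) (hc x hx))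
    (fun x hx => congrArg (fun q : PathEnds p => q.1.1.2) (hc x hx))
  obtain ⟨g, cg, hg, gS⟩ := h (fun z => (f z.1).1.2 z.2) Ψ
    (continuous_eval.comp ((cf.snd.comp continuous_fst).prodMk continuous_snd)) cΨ (by
      rintro ⟨x, t⟩ (hx | rfl | rfl)
      · rw [hΨS x hx]
        exact congrArg (fun q : PathEnds p => q.1.2 t) (hc x hx)
      · rw [hΨ₀]
        exact (f x).2.1.symm
      · rw [hΨ₁]
        exact (f x).2.2.symm)
  refine ⟨ContinuousMap.curry ⟨g, cg⟩, (ContinuousMap.curry ⟨g, cg⟩).continuous, fun x => ?_,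
    fun x hx => ContinuousMap.ext fun t => (gS (x, t) (.inl hx)).trans (hΨS x hx t)⟩
  refine Subtype.ext (Prod.ext (Prod.ext ?_ ?_) (ContinuousMap.ext fun t => hg (x, t)))
  · exact (gS (x, 0) (.inr (.inl rfl))).trans (hΨ₀ x)
  · exact (gS (x, 1) (.inr (.inr rfl))).trans (hΨ₁ x)

/-- The homotopy is regarded as a map from `K` to a path space, so that no cell structure on
`K × I` is needed. -/
theorem exists_homotopy_lift_of_hasRLP (cp : Continuous p)
    (hp : ∀ n, HasRLP p (Cube.boundary (Fin n))) {K : Type w} [TopologicalSpace K] [T2Space K]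
    {k₀ : K} [Topology.RelCWComplex (Set.univ : Set K) {k₀}] {g₀ g₁ : K → E}
    (cg₀ : Continuous g₀) (cg₁ : Continuous g₁) {H : K × I → B} (cH : Continuous H)
    (H0 : ∀ x, H (x, 0) = p (g₀ x)) (H1 : ∀ x, H (x, 1) = p (g₁ x)) {e : E} (he₀ : g₀ k₀ = e)
    (he₁ : g₁ k₀ = e) (He : ∀ t, H (k₀, t) = p e) :
    ∃ L : K × I → E, Continuous L ∧ (∀ z, p (L z) = H z) ∧ (∀ x, L (x, 0) = g₀ x) ∧
      (∀ x, L (x, 1) = g₁ x) ∧ ∀ t, L (k₀, t) = e := by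
  let F : C(K, C(I, B)) := ContinuousMap.curry ⟨H, cH⟩
  have hprism : ∀ n, HasRLP p (prismBoundary (Cube.boundary (Fin n))) := fun n =>
    .of_homeomorph (cubeSplit n) (by rw [cubeSplit_preimage]; exact hp _)
  obtain ⟨L, cL, hL, hLe⟩ := exists_lift_of_hasRLP (k₀ := k₀) (e₀ := ContinuousMap.const I e)
    (fun n => HasRLP.toPathEnds cp (isClosed_cubeBoundary n) (hprism n))
    (f := fun x => ⟨((g₀ x, g₁ x), F x), H0 x, H1 x⟩)
    (((cg₀.prodMk cg₁).prodMk F.continuous).subtype_mk _)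
    (Subtype.ext (Prod.ext (Prod.ext he₀.symm he₁.symm) (ContinuousMap.ext fun t => (He t).symm)))
  exact ⟨fun z => L z.1 z.2, by fun_prop,
    fun z => congrArg (fun q : PathEnds p => q.1.2 z.2) (hL z.1),
    fun x => congrArg (fun q : PathEnds p => q.1.1.1) (hL x),
    fun x => congrArg (fun q : PathEnds p => q.1.1.2) (hL x),
    fun t => congrArg (fun l : C(I, E) => l t) hLe⟩

end PathEnds

/-! ### Pointed maps whose path fibration has the lifting property -/

section Whitehead

variable {Z : Type u} [TopologicalSpace Z] {W : Type v} [TopologicalSpace W]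

/-- The points of the mapping path space with constant path. -/
def MapPath.const {u : Z → W} (hu : Continuous u) : C(Z, MapPath u) :=
  MapPath.family (.id Z) ⟨fun q => u q.1, by fun_prop⟩ fun _ => rfl

variable [Based Z] [Based W] {u : PMap Z W}
  (hu : ∀ n, HasRLP (MapPath.endpt : MapPath u.toMap → W) (Cube.boundary (Fin n)))
include hu

section CWComplex

variable {K : Type w} [TopologicalSpace K] [Based K] [T2Space K]
  [Topology.RelCWComplex (Set.univ : Set K) {(Based.pt : K)}]

theorem PMap.exists_comp_homotopic_of_hasRLP (f : PMap K W) : ∃ g, (u.comp g).Homotopic f := by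
  obtain ⟨q, cq, hq, hq₀⟩ := exists_lift_of_hasRLP (K := K) hu f.toMap.continuous
    (e₀ := MapPath.const u.toMap.continuous Based.pt) (u.map_pt.trans f.map_pt.symm)
  refine ⟨⟨⟨fun x => (q x).1.1, by fun_prop⟩, congrArg (fun z => z.1.1) hq₀⟩,
    PMap.homotopic_of_family _ _ (fun s x => (q x).1.2 s) (by fun_prop) (fun x => (q x).2) hq
      fun s => (congrArg (fun z => z.1.2 s) hq₀).trans u.map_pt⟩

theorem PMap.homotopic_of_comp_of_hasRLP {f g : PMap K Z}
    (h : (u.comp f).Homotopic (u.comp g)) : f.Homotopic g := by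
  obtain ⟨H, cH, H0, H1, Hp⟩ := h.family
  let c := MapPath.const u.toMap.continuous
  obtain ⟨L, cL, -, L0, L1, Lp⟩ := exists_homotopy_lift_of_hasRLP (K := K)
    MapPath.continuous_endpt hu (c.continuous.comp f.toMap.continuous)
    (c.continuous.comp g.toMap.continuous) (H := fun z => H z.2 z.1) (cH.comp continuous_swap)
    H0 H1 (e := c Based.pt) (congrArg c f.map_pt) (congrArg c g.map_pt)
    fun t => (Hp t).trans u.map_pt.symm
  exact PMap.homotopic_of_family _ _ (fun t x => (L (x, t)).1.1)
    (by fun_prop)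
    (fun x => congrArg (fun q => q.1.1) (L0 x)) (fun x => congrArg (fun q => q.1.1) (L1 x))
    fun t => congrArg (fun q => q.1.1) (Lp t)

end CWComplex

variable {A : Type w} [TopologicalSpace A] [Based A] (hA : HasPointedCWType A)
include hA

theorem HasPointedCWType.exists_comp_homotopic (f : PMap A W) :
    ∃ g, (u.comp g).Homotopic f := by
  obtain ⟨K, _, _, _, _, i, r, hri, -⟩ := hA
  obtain ⟨g, hg⟩ := PMap.exists_comp_homotopic_of_hasRLP hu (f.comp r)
  exact ⟨g.comp i, (PMap.comp_homotopic hg (.refl i.toMap)).trans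
    (PMap.comp_homotopic (.refl f.toMap) hri)⟩

theorem HasPointedCWType.homotopic_of_comp {f g : PMap A Z}
    (h : (u.comp f).Homotopic (u.comp g)) : f.Homotopic g := by
  obtain ⟨K, _, _, _, _, i, r, hri, -⟩ := hA
  have hretract : ∀ f : PMap A Z, ((f.comp r).comp i).Homotopic f := fun f =>
    PMap.comp_homotopic (.refl f.toMap) hri
  have hcomp : ((u.comp f).comp r).Homotopic ((u.comp g).comp r) :=
    PMap.comp_homotopic h (.refl r.toMap)
  have hr : (f.comp r).Homotopic (g.comp r) := PMap.homotopic_of_comp_of_hasRLP hu hcomp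
  exact ((hretract f).symm.trans (PMap.comp_homotopic hr (.refl i.toMap))).trans (hretract g)

end Whitehead

/-! ### The adjunction between suspension and loop space -/

section Adjunction

variable {A : Type u} [TopologicalSpace A] [Based A] {Y : Type v} [TopologicalSpace Y] [Based Y]

instance : Based (Path (Based.pt : Y) Based.pt) := ⟨Path.refl _⟩

/-- The power map on the loop space, as a pointed map. -/
def loopPower (Y : Type u) [TopologicalSpace Y] [Based Y] (N : ℕ) :
    PMap (Path (Based.pt : Y) Based.pt) (Path (Based.pt : Y) Based.pt) :=
  ⟨⟨pathWrap N, continuous_pathWrap N⟩, rfl⟩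

theorem PMap.map_susp_pt (f : PMap (Susp A) Y) {a : A} {t : I}
    (h : a = Based.pt ∨ t = 0 ∨ t = 1) : f.toMap (Susp.mk a t) = Based.pt := by
  rw [Susp.mk_eq_pt.2 h, f.map_pt]

/-- The map `A → ΩY` adjoint to a map `ΣA → Y`. -/
def PMap.toLoop (f : PMap (Susp A) Y) : PMap A (Path (Based.pt : Y) Based.pt) where
  toMap := ⟨fun a =>
      { toFun := fun t => f.toMap (Susp.mk a t)
        continuous_toFun := f.toMap.continuous.comp
          (Susp.continuous_mk.comp (by fun_prop : Continuous fun t : I => (a, t)))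
        source' := f.map_susp_pt (.inr (.inl rfl))
        target' := f.map_susp_pt (.inr (.inr rfl)) },
    continuous_path_of_family (f.toMap.continuous.comp Susp.continuous_mk)⟩
  map_pt := Path.ext (funext fun _ => f.map_susp_pt (.inl rfl))

/-- The map `ΣA → Y` adjoint to a map `A → ΩY`. -/
def PMap.fromLoop (g : PMap A (Path (Based.pt : Y) Based.pt)) : PMap (Susp A) Y :=
  PMap.ofSusp (fun a t => g.toMap a t) (by fun_prop) (by
    rintro a t (rfl | rfl | rfl)
    · rw [g.map_pt]; rfl
    · exact (g.toMap a).source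
    · exact (g.toMap a).target)

theorem PMap.fromLoop_toLoop (f : PMap (Susp A) Y) : f.toLoop.fromLoop = f :=
  PMap.ext_apply (Susp.ind fun _ _ => rfl)

theorem PMap.toLoop_fromLoop (g : PMap A (Path (Based.pt : Y) Based.pt)) :
    g.fromLoop.toLoop = g :=
  PMap.ext_apply fun _ => Path.ext rfl

theorem PMap.toLoop_comp_suspWrap (f : PMap (Susp A) Y) (N : ℕ) :
    (f.comp (suspWrap A N)).toLoop = (loopPower Y N).comp f.toLoop :=
  PMap.ext_apply fun _ => Path.ext rfl

theorem PMap.Homotopic.toLoop {f g : PMap (Susp A) Y} (h : f.Homotopic g) :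
    f.toLoop.Homotopic g.toLoop := by
  obtain ⟨H, cH, H0, H1, Hp⟩ := h.family
  let G : I → PMap (Susp A) Y := fun s =>
    ⟨⟨H s, cH.comp (by fun_prop : Continuous fun z : Susp A => (s, z))⟩, Hp s⟩
  have cG : Continuous fun q : (I × A) × I => H q.1.1 (Susp.mk q.1.2 q.2) :=
    cH.comp (continuous_fst.fst.prodMk
      (Susp.continuous_mk.comp (by fun_prop : Continuous fun q : (I × A) × I => (q.1.2, q.2))))
  exact PMap.homotopic_of_family _ _ (fun s => (G s).toLoop.toMap)
    (continuous_path_of_family (L := fun q : I × A => (G q.1).toLoop.toMap q.2) cG)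
    (fun a => Path.ext (funext fun t => H0 _)) (fun a => Path.ext (funext fun t => H1 _))
    fun s => (G s).toLoop.map_pt

theorem PMap.Homotopic.fromLoop {f g : PMap A (Path (Based.pt : Y) Based.pt)}
    (h : f.Homotopic g) : f.fromLoop.Homotopic g.fromLoop := by
  obtain ⟨H, cH, H0, H1, Hp⟩ := h.family
  let G : I → PMap A (Path (Based.pt : Y) Based.pt) := fun s =>
    ⟨⟨H s, cH.comp (by fun_prop : Continuous fun a : A => (s, a))⟩, Hp s⟩
  have cG : Continuous fun q : I × (A × I) => H q.1 q.2.1 q.2.2 := by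
    have := cH.comp (by fun_prop : Continuous fun q : I × (A × I) => (q.1, q.2.1))
    exact continuous_eval.comp (this.prodMk continuous_snd.snd)
  exact PMap.homotopic_of_family _ _ (fun s => (G s).fromLoop.toMap)
    (Susp.continuous_param (fun s => (G s).fromLoop.toMap) cG)
    (Susp.ind fun a t => congrArg (fun l : Path (Based.pt : Y) Based.pt => l t) (H0 a))
    (Susp.ind fun a t => congrArg (fun l : Path (Based.pt : Y) Based.pt => l t) (H1 a))
    fun s => (G s).fromLoop.map_pt

theorem PMap.toLoop_homotopic_iff {f g : PMap (Susp A) Y} :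
    f.toLoop.Homotopic g.toLoop ↔ f.Homotopic g :=
  ⟨fun h => by simpa only [PMap.fromLoop_toLoop] using! h.fromLoop, fun h => h.toLoop⟩

theorem exists_inverse_suspWrap [SimplyConnectedSpace (Susp A)] (hA : HasPointedCWType A) {N : ℕ}
    (hN : ∀ m, Function.Bijective
      fun g : HomotopyGroup (Fin (m + 1)) (Susp A) Based.pt => g ^ N) :
    ∃ g : PMap (Susp A) (Susp A), (g.comp (suspWrap A N)).Homotopic (PMap.id _) ∧
      ((suspWrap A N).comp g).Homotopic (PMap.id _) := by
  have hRLP := hasRLP_pathWrap hN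
  obtain ⟨γ, hγ⟩ := HasPointedCWType.exists_comp_homotopic (u := loopPower (Susp A) N) hRLP hA
    (PMap.id (Susp A)).toLoop
  have hleft : (γ.fromLoop.comp (suspWrap A N)).Homotopic (PMap.id _) := by
    rwa [← PMap.toLoop_homotopic_iff, PMap.toLoop_comp_suspWrap, PMap.toLoop_fromLoop]
  refine ⟨γ.fromLoop, hleft, PMap.toLoop_homotopic_iff.1 <|
    HasPointedCWType.homotopic_of_comp (u := loopPower (Susp A) N) hRLP hA ?_⟩
  rw [← PMap.toLoop_comp_suspWrap, ← PMap.toLoop_comp_suspWrap]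
  have hcomp : ((suspWrap A N).comp (γ.fromLoop.comp (suspWrap A N))).Homotopic
      ((suspWrap A N).comp (PMap.id _)) := PMap.comp_homotopic (.refl (suspWrap A N).toMap) hleft
  exact hcomp.toLoop

end Adjunction

section PLocal

variable {p : ℕ}

theorem IsPLocal.pow_bijective {X : Type u} [TopologicalSpace X] [Based X] (hX : IsPLocal p X)
    {N : ℕ} (hN : ¬ p ∣ N) (m : ℕ) :
    Function.Bijective fun g : HomotopyGroup (Fin (m + 1)) X Based.pt => g ^ N := by
  induction N using induction_on_primes with
  | zero => exact absurd (dvd_zero p) hN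
  | one => simpa only [pow_one] using! Function.bijective_id
  | prime_mul q N hq ih =>
    have hq := hX.2 m q hq fun h => hN (h ▸ dvd_mul_right q N)
    simp only [pow_mul]
    exact (ih fun h => hN (h.mul_left q)).comp hq

theorem IsPLocal.nsmul_bijective {n : ℕ} [NeZero n] {A : Type u} [TopologicalSpace A] [Based A]
    [T1Space A] (hA : HasPointedCWType A) (hX : IsPLocal p (Susp A)) {W : Type v}
    [TopologicalSpace W] [Based W] {N : ℕ} (hN : ¬ p ∣ N) :
    Function.Bijective fun c : HClass (Smash n (Susp A)) W => N • c := by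
  have := hX.1
  obtain ⟨g, hleft, hright⟩ := exists_inverse_suspWrap hA (hX.pow_bijective hN)
  exact HClass.nsmul_bijective hleft hright

end PLocal

end LabelTrace

end

open LabelTrace in
theorem proposition4p4_general (p : ℕ) [Fact p.Prime] (n : ℕ) [NeZero n]
    (A : Type*) [TopologicalSpace A] [Based A] [T1Space A] (hA : HasPointedCWType A)
    (hX : IsPLocal p (Susp A)) (M : FunctorialRetract (ZLoc p) n) (hM : M.ContainsBottomCell) :
    (∃ e, M.IsInducedBy e) ∧ ∀ e, M.IsInducedBy e →
      (∃! c : HClass (Smash n (Susp A)) (Smash n (Susp A)), Represents p e c) ∧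
      ∀ a : PMap (Smash n (Susp A)) (Smash n (Susp A)), Represents p e a.cls →
        ∃ b : PMap (Hocolim a) (Smash n (Susp A)),
          (b.comp (Hocolim.incl a)).cls = traceClass n A := by
  have hdiv : ∀ N : ℕ, ¬ p ∣ N → Function.Bijective
      fun c : HClass (Smash n (Susp A)) (Smash n (Susp A)) => N • c :=
    fun N hN => hX.nsmul_bijective hA hN
  refine ⟨M.exists_isInducedBy, fun e he => ⟨existsUnique_represents hdiv e, fun a ha => ?_⟩⟩
  obtain ⟨φ, hφ : φ.cls = traceClass n A⟩ := Quotient.exists_rep (traceClass n A)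
  have habsorb : (φ.comp a).cls = φ.cls :=
    cls_comp_eq_of_represents (fun N hN => (hdiv N hN).1)
      (FunctorialRetract.sum_coeff_eq_one hM he) ha fun τ => by
        rw [hφ, HClass.precompPerm_traceClass]
  obtain ⟨b, hb⟩ := Hocolim.exists_comp_incl_eq a φ (Quotient.exact habsorb).symm
  exact ⟨b, by rw [hb, hφ]⟩

theorem proposition4p4 (p : ℕ) [Fact p.Prime] (n : ℕ) [NeZero n]
    (A : Type*) [TopologicalSpace A] [LabelTrace.Based A] [T1Space A]
    (hA : LabelTrace.HasPointedCWType A) (hX : LabelTrace.IsPLocal p (LabelTrace.Susp A))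
    (M : LabelTrace.FunctorialRetract (LabelTrace.ZLoc p) n) (hM : M.IsSmallest) :
    (∃ e, M.IsInducedBy e) ∧ ∀ e, M.IsInducedBy e →
      (∃! c : LabelTrace.HClass (LabelTrace.Smash n (LabelTrace.Susp A))
        (LabelTrace.Smash n (LabelTrace.Susp A)), LabelTrace.Represents p e c) ∧
      ∀ a : LabelTrace.PMap (LabelTrace.Smash n (LabelTrace.Susp A))
        (LabelTrace.Smash n (LabelTrace.Susp A)), LabelTrace.Represents p e a.cls →
        ∃ b : LabelTrace.PMap (LabelTrace.Hocolim a) (LabelTrace.Smash n (LabelTrace.Susp A)),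
          (b.comp (LabelTrace.Hocolim.incl a)).cls = LabelTrace.traceClass n A :=
  proposition4p4_general p n A hA hX M hM.1
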